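/- Let $\Lambda, M\subset\mathbb{R}$ be multisets (families of real numbers, in which a point may occur several times), let $r:\Lambda\to\mathbb{Z}_{\ge 0}$, $k:M\to\mathbb{Z}_{\ge 0}$, and let $a_\lambda, b_\mu:\mathbb{R}\to\mathbb{C}$ be functions for $\lambda\in\Lambda$, $\mu\in M$. For $R>0$ let $n_\Lambda(R), n_M(R)\in\{0,1,2,\dots,\infty\}$ be the numbers of elements of $\Lambda$, respectively of $M$, in $[-R,R]$, counted with multiplicity, and let $\hat f(\xi)=\int_{\mathbb{R}} f(x)e^{-2\pi i x\xi}\,dx$. Consider the interpolation formula $$f(x)=\sum_{\lambda\in\Lambda} f^{(r(\lambda))}(\lambda)\,a_\lambda(x)+\sum_{\mu\in M}\hat f^{(k(\mu))}(\mu)\,b_\mu(x)\qquad(x\in\mathbb{R}),\tag{$*$}$$ where each of the two sums converges, unconditionally or with respect to some fixed order or grouping of its terms. Assume that there is a real number $L$ such that $k(\mu)\le L$ for all $\mu\in M$ and $n_M(R)\le R^L$ for all sufficiently large $R$, and that $b_\mu(x)$ is polynomially bounded in $\mu$ and $x$: there are $K$ and $N$ with $|b_\mu(x)|\le K(1+|x|+|\mu|)^N$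 for all $\mu\in M$, $x\in\mathbb{R}$. 1. If $(*)$ holds for all compactly supported $C^\infty$ functions $f:\mathbb{R}\to\mathbb{C}$, then for every $\varepsilon>0$ there is $C>0$ (depending on $\varepsilon$ and the interpolation formula) such that for all $R_1,R_2>1$ $$n_\Lambda(R_1)+n_M(R_2)\ge 4R_1R_2-C\log^{2+\varepsilon}(4R_1R_2).$$ 2. If $(*)$ holds for all even compactly supported $C^\infty$ functions, or if it holds for all odd ones, then for every $\varepsilon>0$ there is $C>0$ such that for all $R_1,R_2>1$ $$n_\Lambda(R_1)+n_M(R_2)\ge 2R_1R_2-C\log^{2+\varepsilon}(2R_1R_2).$$ -/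

import Mathlib

open scoped ENNReal ContDiff FourierTransform

/-- A multiset of real numbers is given as a family `p : ι → ℝ` (a point occurs once for each index
mapped to it). `countIn p R` is the number of its elements in `[-R, R]`, counted with multiplicity;
it is `⊤` if there are infinitely many. -/
noncomputable def countIn {ι : Type*} (p : ι → ℝ) (R : ℝ) : ℕ∞ :=
  {i : ι | |p i| ≤ R}.encard

/-- The interpolation formula
`f x = ∑ i, f^(r i) (Λ i) * a i x + ∑ j, (𝓕 f)^(k j) (M j) * b j x`
holds at every real `x`, for all smooth compactly supported `f : ℝ → ℂ` in the class `P`. The first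
sum converges along the summation method `S`, the second along `T`. -/
def InterpolationFormula {ι κ : Type*} (P : (ℝ → ℂ) → Prop)
    (S : SummationFilter ι) (T : SummationFilter κ)
    (Λ : ι → ℝ) (r : ι → ℕ) (a : ι → ℝ → ℂ)
    (M : κ → ℝ) (k : κ → ℕ) (b : κ → ℝ → ℂ) : Prop :=
  ∀ f : ℝ → ℂ, ContDiff ℝ ∞ f → HasCompactSupport f → P f → ∀ x : ℝ, ∃ u v : ℂ,
    HasSum (fun i => iteratedDeriv (r i) f (Λ i) * a i x) u S ∧
    HasSum (fun j => iteratedDeriv (k j) (𝓕 f) (M j) * b j x) v T ∧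
    f x = u + v

/-- For every `ε > 0` there is a constant `C > 0` such that
`n_Λ(R₁) + n_M(R₂) ≥ c R₁ R₂ - C log ^ (2 + ε) (c R₁ R₂)` for all `R₁, R₂ > 1`. The inequality is
between extended reals because the counting functions may be infinite. -/
def CountingLowerBound {ι κ : Type*} (c : ℝ) (Λ : ι → ℝ) (M : κ → ℝ) : Prop :=
  ∀ ε : ℝ, 0 < ε → ∃ C : ℝ, 0 < C ∧ ∀ R₁ R₂ : ℝ, 1 < R₁ → 1 < R₂ →
    ((c * R₁ * R₂ - C * Real.log (c * R₁ * R₂) ^ (2 + ε) : ℝ) : EReal) ≤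
      (((countIn Λ R₁ + countIn M R₂ : ℕ∞) : ℝ≥0∞) : EReal)

/-! The proof is a dimension count. Trigonometric polynomials of period `2 R₁` with frequencies in
`[-R₂, R₂]` form a space of dimension about `4 R₁ R₂`, and about half that in the even or odd class.
Multiply such a polynomial by an even cutoff `χ` of `[-R₁, R₁]`. If the dimension exceeds `n_Λ(R₁) +
n_M(R₂) + O(log²)`, some nonzero product `f` annihilates every term with `|λ| ≤ R₁` or `|μ| ≤ R₂`
and satisfies `O(log²)` further linear conditions. The terms with `|λ| > R₁` vanish by support, so
`f` equals the sum over `|μ| > R₂`.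

The further conditions make that sum smaller than the largest coefficient `γ` (`exists_cutoff`, with
`exists_sum_inv_pow_le` for summability). But `|f| ≥ γ` at some point where `χ = 1`
(`exists_norm_coeff_le_trigPoly`), a contradiction; this is
`InterpolationFormula.exists_dimension_le`.

Why `log²` conditions suffice: `χ` must reach 1 within about `R₁ / N` of the ends, too steep to
treat at one scale. It is split into `O(log)` dyadic windows of radius `ρ` and bandwidth `b` with `ρ
b = O(m)`, `m` of order `log (R₁ R₂)`. Beyond distance `b` from the band, `m` derivatives give a
factor `2 ^ (-m)`. Closer in, `O(m)` vanishing moments at `± R₂` give the same gain by Taylor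
expansion (`norm_fourier_le_of_moments`). -/

/-! ### Smooth steps with controlled derivatives -/

/-- The average of `f` over `[x - h, x]` is smooth, and averaging gains one derivative. -/
theorem exists_average {f : ℝ → ℂ} (hf : ContDiff ℝ ∞ f) {h a b : ℝ} (hh : 0 < h) {m : ℕ}
    (hb : 2 / h ≤ b) (h0 : ∀ x ≤ 0, f x = 0) (h1 : ∀ x, a ≤ x → f x = 1)
    (hd : ∀ n ≤ m, ∀ x, ‖iteratedDeriv n f x‖ ≤ b ^ n) :
    ∃ g : ℝ → ℂ, ContDiff ℝ ∞ g ∧ (∀ x ≤ 0, g x = 0) ∧ (∀ x, a + h ≤ x → g x = 1) ∧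
      ∀ n ≤ m + 1, ∀ x, ‖iteratedDeriv n g x‖ ≤ b ^ n := by
  have hc := hf.continuous
  have hii : ∀ u v, IntervalIntegrable f MeasureTheory.volume u v :=
    fun u v => hc.intervalIntegrable u v
  have hbpos : 0 < b := lt_of_lt_of_le (by positivity) hb
  set F : ℝ → ℂ := fun x => ∫ t in (0:ℝ)..x, f t with hF
  have hFd : ∀ x, HasDerivAt F (f x) x := fun x =>
    intervalIntegral.integral_hasDerivAt_right (hii _ _)
      hc.stronglyMeasurable.stronglyMeasurableAtFilter hc.continuousAt
  have hFdiff : ∀ u v, F u - F v = ∫ t in v..u, f t := fun u v => by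
    rw [hF]; exact intervalIntegral.integral_interval_sub_left (hii _ _) (hii _ _)
  have hFdv : deriv F = f := funext fun x => (hFd x).deriv
  have hFs : ContDiff ℝ ∞ F := by
    rw [contDiff_infty_iff_deriv]
    exact ⟨fun x => (hFd x).differentiableAt, by rwa [hFdv]⟩
  set g : ℝ → ℂ := fun x => (h:ℂ)⁻¹ * (F x - F (x - h)) with hg
  have hgs : ContDiff ℝ ∞ g :=
    contDiff_const.mul (hFs.sub (hFs.comp (contDiff_id.sub contDiff_const)))
  have hgF : ∀ n x, iteratedDeriv n g x =
      (h:ℂ)⁻¹ * (iteratedDeriv n F x - iteratedDeriv n F (x - h)) := by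
    intro n x
    rw [hg, iteratedDeriv_const_mul_field, iteratedDeriv_fun_sub]
    · rw [iteratedDeriv_comp_sub_const]
    · exact (hFs.of_le (by exact_mod_cast le_top)).contDiffAt
    · exact ((hFs.comp (contDiff_id.sub contDiff_const)).of_le
        (by exact_mod_cast le_top)).contDiffAt
  have hhn : ‖(h:ℂ)⁻¹‖ = h⁻¹ := by simp [abs_of_pos hh]
  refine ⟨g, hgs, ?_, ?_, ?_⟩
  · intro x hx
    have : F x - F (x - h) = 0 := by
      rw [hFdiff]
      apply intervalIntegral.integral_zero_ae
      refine .of_forall fun t ht => h0 t ?_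
      rw [Set.uIoc_of_le (by linarith)] at ht
      exact ht.2.trans hx
    simp [hg, this]
  · intro x hx
    have : F x - F (x - h) = h := by
      rw [hFdiff, intervalIntegral.integral_congr (g := fun _ => (1:ℂ))]
      · simp
      · intro t ht
        rw [Set.uIcc_of_le (by linarith)] at ht
        exact h1 t (by linarith [ht.1])
    simp only [hg, this]
    exact inv_mul_cancel₀ (by exact_mod_cast hh.ne')
  -- Up to order `m` averaging preserves the bounds, by the mean value inequality for derivatives of
  -- `F`. At order `m + 1` the difference quotient of `f^(m)` costs `2 / h ≤ b`.
  · have key : ∀ n ≤ m, ∀ x, ‖iteratedDeriv n g x‖ ≤ b ^ n := by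
      intro n hn x
      have hmv : ‖iteratedDeriv n F x - iteratedDeriv n F (x - h)‖ ≤ b ^ n * ‖x - (x - h)‖ := by
        apply Convex.norm_image_sub_le_of_norm_deriv_le (s := Set.univ) _ _ convex_univ trivial
          trivial
        · intro y _
          exact (hFs.differentiable_iteratedDeriv n (by exact_mod_cast WithTop.coe_lt_top _)) y
        · intro y _
          rw [← iteratedDeriv_succ, iteratedDeriv_succ', hFdv]
          exact hd n hn y
      rw [hgF, norm_mul, hhn]
      have : ‖x - (x - h)‖ = h := by simp [abs_of_pos hh]
      rw [this] at hmv
      calc h⁻¹ * _ ≤ h⁻¹ * (b ^ n * h) := by gcongr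
        _ = b ^ n := by field_simp
    intro n hn x
    rcases Nat.lt_or_ge m n with hlt | hle
    · obtain rfl : n = m + 1 := by omega
      rw [hgF, norm_mul, hhn, iteratedDeriv_succ', hFdv]
      calc h⁻¹ * ‖iteratedDeriv m f x - iteratedDeriv m f (x - h)‖
          ≤ h⁻¹ * (b ^ m + b ^ m) := by
            gcongr
            exact (norm_sub_le _ _).trans (add_le_add (hd m le_rfl _) (hd m le_rfl _))
        _ = b ^ m * (2 / h) := by ring
        _ ≤ b ^ m * b := by gcongr
        _ = b ^ (m + 1) := by ring
    · exact key n hle x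

/-- A smooth step of width one whose first `m` derivatives are bounded by powers of `4 m`. -/
theorem exists_smooth_step {m : ℕ} (hm : 0 < m) :
    ∃ θ : ℝ → ℂ, ContDiff ℝ ∞ θ ∧ (∀ x ≤ 0, θ x = 0) ∧ (∀ x, 1 ≤ x → θ x = 1) ∧
      ∀ n ≤ m, ∀ x, ‖iteratedDeriv n θ x‖ ≤ (4 * m : ℝ) ^ n := by
  have hm' : (0:ℝ) < m := by exact_mod_cast hm
  -- A step of width `1 / 2` is averaged `m` times at width `h = 1 / (2 m)`: the total width is 1
  -- and `2 / h = 4 m`. The initial step needs only the bound of order zero.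
  have : ∀ k : ℕ, ∃ θ : ℝ → ℂ, ContDiff ℝ ∞ θ ∧ (∀ x ≤ 0, θ x = 0) ∧
      (∀ x, 1 / 2 + k * (1 / (2 * m) : ℝ) ≤ x → θ x = 1) ∧
      ∀ n ≤ k, ∀ x, ‖iteratedDeriv n θ x‖ ≤ (4 * m : ℝ) ^ n := by
    intro k
    induction k with
    | zero =>
      refine ⟨fun x => (Real.smoothTransition (2 * x) : ℂ), ?_, ?_, ?_, ?_⟩
      · exact Complex.ofRealCLM.contDiff.comp
          (Real.smoothTransition.contDiff.comp (contDiff_const.mul contDiff_id))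
      · intro x hx
        simp [Real.smoothTransition.zero_of_nonpos (x := 2 * x) (by linarith)]
      · intro x hx
        simp [Real.smoothTransition.one_of_one_le (x := 2 * x) (by norm_num at hx; linarith)]
      · intro n hn x
        obtain rfl : n = 0 := by omega
        simp [abs_of_nonneg (Real.smoothTransition.nonneg _), Real.smoothTransition.le_one]
    | succ k ih =>
      obtain ⟨f, hf, h0, h1, hd⟩ := ih
      obtain ⟨g, hg, g0, g1, gd⟩ := exists_average hf (h := 1 / (2 * m : ℝ)) (by positivity)
        (b := 4 * m) (le_of_eq (by field_simp; norm_num)) h0 h1 hd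
      exact ⟨g, hg, g0, fun x hx => g1 x (by push_cast at hx; linarith), gd⟩
  obtain ⟨θ, h, h0, h1, hd⟩ := this m
  refine ⟨θ, h, h0, fun x hx => h1 x (le_trans (le_of_eq ?_) hx), hd⟩
  field_simp; norm_num

theorem norm_iteratedDeriv_comp_mul_add_le {θ : ℝ → ℂ} (hθ : ContDiff ℝ ∞ θ) {n : ℕ} {B : ℝ}
    (hB : ∀ x, ‖iteratedDeriv n θ x‖ ≤ B) (s v x : ℝ) :
    ‖iteratedDeriv n (fun x => θ (s * x + v)) x‖ ≤ |s| ^ n * B := by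
  have h1 : ContDiff ℝ n (fun x => θ (x + v)) :=
    (hθ.comp (contDiff_id.add contDiff_const)).of_le (by exact_mod_cast le_top)
  rw [iteratedDeriv_comp_const_smul h1 s, iteratedDeriv_comp_add_const, norm_smul, norm_pow,
    Real.norm_eq_abs]
  gcongr
  exact hB _

/-! ### Dyadic windows summing to a cutoff -/

/-- A smooth function on `[-R, R]`, supported within distance `ρ` of `c`, with `n`-th derivative
at most `3 b ^ n` for `n ≤ m`, where `b` is comparable to `m / ρ`. -/
structure IsWindow (R : ℝ) (m : ℕ) (c ρ b : ℝ) (χ : ℝ → ℂ) : Prop where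
  smooth : ContDiff ℝ ∞ χ
  zero_of_lt : ∀ x, R < |x| → χ x = 0
  zero_far : ∀ x, ρ < |x - c| → χ x = 0
  deriv_le : ∀ n ≤ m, ∀ x, ‖iteratedDeriv n χ x‖ ≤ 3 * b ^ n
  radius_mul_le : ρ * b ≤ 8 * m
  le_b : 4 * m / R ≤ b

/-- A smooth even cutoff of `[-R, R]`, equal to one up to distance `R / 2 ^ J` from the ends, is a
sum of `2 J + 1` windows. -/
theorem exists_windows {R : ℝ} (hR : 0 < R) {m : ℕ} (hm : 0 < m) (J : ℕ) :
    ∃ (χ : Option (Fin J × Bool) → ℝ → ℂ) (c ρ b : Option (Fin J × Bool) → ℝ),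
      (∀ i, IsWindow R m (c i) (ρ i) (b i) (χ i)) ∧ (∀ i, b i ≤ 4 * m * 2 ^ J / R) ∧
      (∀ x, ∑ i, χ i (-x) = ∑ i, χ i x) ∧
      ∀ x, |x| ≤ R - R / 2 ^ J → ∑ i, χ i x = 1 := by
  obtain ⟨θ, hs, h0, h1, hd⟩ := exists_smooth_step hm
  have hm' : (0:ℝ) < m := by exact_mod_cast hm
  set w : ℕ → ℝ := fun j => R / 2 ^ j with hw
  have hwp : ∀ j, 0 < w j := fun j => by simp only [hw]; positivity
  have hwR : ∀ j, w j ≤ R := fun j => div_le_self hR.le (one_le_pow₀ (by norm_num))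
  have hws : ∀ j, w j = 2 * w (j + 1) := fun j => by simp only [hw]; field_simp; ring
  set h : ℕ → ℝ → ℂ := fun j x => θ ((x + R) / w j) with hh
  have hfun : ∀ j, h j = fun x => θ ((1 / w j) * x + R / w j) := fun j => by
    funext x; simp only [hh]; congr 1; ring
  have hfun' : ∀ j, (fun x => h j (-x)) = fun x => θ ((-1 / w j) * x + R / w j) := fun j => by
    funext x; simp only [hh]; congr 1; ring
  have hsm : ∀ s v : ℝ, ContDiff ℝ ∞ (fun x => θ (s * x + v)) := fun s v =>
    hs.comp ((contDiff_const.mul contDiff_id).add contDiff_const)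
  have hhs : ∀ j, ContDiff ℝ ∞ (h j) := fun j => by rw [hfun]; exact hsm _ _
  have hhs' : ∀ j, ContDiff ℝ ∞ (fun x => h j (-x)) := fun j => by rw [hfun']; exact hsm _ _
  have hpw : ∀ j n, |1 / w j| ^ n * (4 * m : ℝ) ^ n = (4 * m / w j) ^ n := fun j n => by
    rw [abs_of_pos (by have := hwp j; positivity), ← mul_pow]; congr 1; ring
  have hhd : ∀ j, ∀ n ≤ m, ∀ x, ‖iteratedDeriv n (h j) x‖ ≤ (4 * m / w j) ^ n := by
    intro j n hn x
    rw [hfun, ← hpw]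
    exact norm_iteratedDeriv_comp_mul_add_le hs (hd n hn) _ _ _
  have hhd' : ∀ j, ∀ n ≤ m, ∀ x, ‖iteratedDeriv n (fun x => h j (-x)) x‖ ≤ (4 * m / w j) ^ n := by
    intro j n hn x
    rw [hfun', ← hpw, show |1 / w j| = |-1 / w j| by rw [neg_div, abs_neg]]
    exact norm_iteratedDeriv_comp_mul_add_le hs (hd n hn) _ _ _
  have hz : ∀ j x, x ≤ -R → h j x = 0 := fun j x hx =>
    h0 _ (div_nonpos_of_nonpos_of_nonneg (by linarith) (hwp j).le)
  have ho : ∀ j x, w j - R ≤ x → h j x = 1 := fun j x hx =>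
    h1 _ (by rw [le_div_iff₀ (hwp j)]; linarith)
  have hle : ∀ {f : ℝ → ℂ}, ContDiff ℝ ∞ f → ∀ (n : ℕ) x, ContDiffAt ℝ n f x :=
    fun hf n x => (hf.of_le (by exact_mod_cast le_top)).contDiffAt
  -- Differences of steps at consecutive scales live within `w j` of the endpoint and telescope to
  -- `h J - h 0`. Since `w j = 2 w (j + 1)`, radius times bandwidth is exactly `8 m`.
  set d : ℕ → ℝ → ℂ := fun j x => h (j + 1) x - h j x with hdd
  have hbd : ∀ j n, (4 * m / w j : ℝ) ^ n ≤ (4 * m / w (j + 1)) ^ n := fun j n => by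
    have := hwp (j + 1)
    have := hws j
    gcongr
    linarith
  have hdw : ∀ j, IsWindow R m (-R) (w j) (4 * m / w (j + 1)) (d j) := by
    intro j
    have hzero : ∀ x, (x < -R ∨ w j - R < x) → d j x = 0 := by
      rintro x (hx | hx)
      · simp [hdd, hz _ _ hx.le]
      · simp only [hdd]
        rw [ho _ _ hx.le, ho _ _ (by linarith [hws j, hwp (j + 1)]), sub_self]
    refine ⟨(hhs _).sub (hhs _), ?_, ?_, ?_, ?_, ?_⟩
    · intro x hx
      apply hzero
      rcases lt_abs.1 hx with hx | hx
      · right; linarith [hwR j]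
      · left; linarith
    · intro x hx
      apply hzero
      rcases lt_abs.1 hx with hx | hx
      · right; linarith
      · left; linarith [hwp j]
    · intro n hn x
      rw [hdd, iteratedDeriv_fun_sub (hle (hhs _) _ _) (hle (hhs _) _ _)]
      refine (norm_sub_le _ _).trans ?_
      have := hhd (j + 1) n hn x
      have := hhd j n hn x
      have := hbd j n
      have : (0:ℝ) ≤ (4 * m / w (j + 1)) ^ n := by have := hwp (j+1); positivity
      linarith
    · rw [hws j]
      have := hwp (j + 1)
      field_simp; norm_num
    · have := hwp (j + 1)
      gcongr
      exact hwR _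
  have hdw' : ∀ j, IsWindow R m R (w j) (4 * m / w (j + 1)) (fun x => d j (-x)) := by
    intro j
    refine ⟨(hhs' _).sub (hhs' _), fun x hx => (hdw j).zero_of_lt _ (by rwa [abs_neg]),
      fun x hx => (hdw j).zero_far _ ?_, ?_, (hdw j).radius_mul_le, (hdw j).le_b⟩
    · rw [abs_sub_comm] at hx
      convert hx using 2
      ring
    · intro n hn x
      simp only [hdd]
      rw [iteratedDeriv_fun_sub (hle (hhs' _) _ _) (hle (hhs' _) _ _)]
      refine (norm_sub_le _ _).trans ?_
      have := hhd' (j + 1) n hn x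
      have := hhd' j n hn x
      have := hbd j n
      have : (0:ℝ) ≤ (4 * m / w (j + 1)) ^ n := by have := hwp (j+1); positivity
      linarith
  -- The central window has three terms, hence the constant 3 in `deriv_le`. Adding the telescoped
  -- differences at both ends turns it into `h J x + h J (-x) - 1`.
  set H : ℝ → ℂ := fun x => h 0 x + h 0 (-x) - 1 with hH
  have hw0 : w 0 = R := by simp [hw]
  have hHzero : ∀ x, R < |x| → H x = 0 := by
    intro x hx
    rcases lt_abs.1 hx with hx | hx
    · simp only [hH]; rw [hz 0 (-x) (by linarith), ho 0 x (by linarith)]; ring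
    · simp only [hH]; rw [hz 0 x (by linarith), ho 0 (-x) (by linarith)]; ring
  have hHw : IsWindow R m 0 R (4 * m / R) H := by
    refine ⟨((hhs 0).add (hhs' 0)).sub contDiff_const, hHzero, fun x hx => hHzero x (by simpa using hx),
      ?_, ?_, le_rfl⟩
    · intro n hn x
      rw [hH, iteratedDeriv_fun_sub (hle ((hhs 0).add (hhs' 0)) _ _) contDiffAt_const,
        iteratedDeriv_fun_add (hle (hhs 0) _ _) (hle (hhs' 0) _ _)]
      have a1 := hhd 0 n hn x
      have a2 := hhd' 0 n hn x
      have a3 : ‖iteratedDeriv n (fun _ : ℝ => (1:ℂ)) x‖ ≤ (4 * m / R) ^ n := by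
        rw [iteratedDeriv_const]
        split_ifs with hn0
        · simp [hn0]
        · simp only [norm_zero]; positivity
      rw [hw0] at a1 a2
      refine (norm_sub_le _ _).trans ?_
      have := norm_add_le (iteratedDeriv n (h 0) x) (iteratedDeriv n (fun x => h 0 (-x)) x)
      linarith
    · field_simp; linarith
  have htel : ∀ x, ∑ j : Fin J, d j x = h J x - h 0 x := fun x => by
    rw [Fin.sum_univ_eq_sum_range (fun j => d j x)]
    exact Finset.sum_range_sub (fun j => h j x) J
  refine ⟨fun i => match i with
      | none => H
      | some (j, true) => d j
      | some (j, false) => fun x => d j (-x),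
    fun i => match i with
      | none => 0
      | some (_, true) => -R
      | some (_, false) => R,
    fun i => match i with
      | none => R
      | some (j, _) => w j,
    fun i => match i with
      | none => 4 * m / R
      | some (j, _) => 4 * m / w (j + 1), ?_, ?_, ?_, ?_⟩
  · rintro (_ | ⟨j, _ | _⟩)
    exacts [hHw, hdw' j, hdw j]
  · rintro (_ | ⟨j, _⟩)
    · have : (1:ℝ) ≤ 2 ^ J := one_le_pow₀ (by norm_num)
      show 4 * (m:ℝ) / R ≤ 4 * m * 2 ^ J / R
      exact div_le_div_of_nonneg_right (le_mul_of_one_le_right (by positivity) this) hR.le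
    · have : (2:ℝ) ^ ((j:ℕ) + 1) ≤ 2 ^ J := pow_le_pow_right₀ (by norm_num) j.2
      simp only [hw]
      rw [div_div_eq_mul_div]
      gcongr
  all_goals
    have hsum : ∀ x : ℝ, ∑ i : Option (Fin J × Bool), (match i with
        | none => H
        | some (j, true) => d j
        | some (j, false) => fun x => d j (-x) : ℝ → ℂ) x = h J x + h J (-x) - 1 := fun x => by
      rw [Fintype.sum_option, Fintype.sum_prod_type]
      simp only [Fintype.sum_bool, Finset.sum_add_distrib, htel, hH]
      ring
  · intro x
    rw [hsum, hsum, neg_neg]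
    ring
  · intro x hx
    rw [hsum]
    have := abs_le.1 hx
    rw [ho J x (by linarith [this.1]), ho J (-x) (by linarith [this.2])]
    ring

/-! ### Fourier transforms of compactly supported functions -/

theorem hasCompactSupport_of_zero_of_lt {g : ℝ → ℂ} {R : ℝ} (hz : ∀ x, R < |x| → g x = 0) :
    HasCompactSupport g := by
  refine HasCompactSupport.intro (isCompact_Icc (a := -R) (b := R)) fun x hx => hz x ?_
  by_contra h
  exact hx (abs_le.1 (not_lt.1 h))

theorem integrable_of_zero_of_lt {g : ℝ → ℂ} (hg : Continuous g) {R : ℝ}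
    (hz : ∀ x, R < |x| → g x = 0) : MeasureTheory.Integrable g :=
  hg.integrable_of_hasCompactSupport (hasCompactSupport_of_zero_of_lt hz)

theorem iteratedDeriv_eq_zero_of_lt {g : ℝ → ℂ} {R : ℝ} (hz : ∀ x, R < |x| → g x = 0) (n : ℕ)
    {x : ℝ} (hx : R < |x|) : iteratedDeriv n g x = 0 := by
  have : g =ᶠ[nhds x] fun _ => 0 := by
    filter_upwards [(isOpen_lt continuous_const continuous_abs).mem_nhds hx] with y hy
    exact hz y hy
  rw [this.iteratedDeriv_eq n, iteratedDeriv_const]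
  simp

theorem norm_fourier_le {g : ℝ → ℂ} {R B : ℝ} (hR : 0 ≤ R) (hz : ∀ x, R < |x| → g x = 0)
    (hB : ∀ x, ‖g x‖ ≤ B) (ξ : ℝ) : ‖𝓕 g ξ‖ ≤ 2 * R * B := by
  rw [Real.fourier_real_eq_integral_exp_smul,
    ← MeasureTheory.setIntegral_eq_integral_of_forall_compl_eq_zero (s := Set.Icc (-R) R)]
  · refine (MeasureTheory.norm_setIntegral_le_of_norm_le_const (C := B) (by simp) ?_).trans ?_
    · intro x _
      rw [norm_smul, Complex.norm_exp_ofReal_mul_I, one_mul]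
      exact hB x
    · rw [MeasureTheory.measureReal_def, Real.volume_Icc, ENNReal.toReal_ofReal (by linarith)]
      apply le_of_eq; ring
  · intro x hx
    rw [hz x, smul_zero]
    by_contra h
    exact hx (abs_le.1 (not_lt.1 h))

theorem integrable_exp_smul {g : ℝ → ℂ} (hg : MeasureTheory.Integrable g) (ξ : ℝ) :
    MeasureTheory.Integrable
      (fun v : ℝ => Complex.exp (((-2 * Real.pi * v * ξ : ℝ) : ℂ) * Complex.I) • g v) := by
  refine hg.bdd_mul (c := 1) ?_ ?_
  · exact (by fun_prop : Continuous _).aestronglyMeasurable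
  · exact .of_forall fun x => by rw [Complex.norm_exp_ofReal_mul_I]

theorem fourier_finset_sum_mul {α : Type*} (s : Finset α) (c : α → ℂ) {g : α → ℝ → ℂ}
    (hg : ∀ i ∈ s, MeasureTheory.Integrable (g i)) (ξ : ℝ) :
    𝓕 (fun x => ∑ i ∈ s, c i * g i x) ξ = ∑ i ∈ s, c i * 𝓕 (g i) ξ := by
  simp only [Real.fourier_real_eq_integral_exp_smul, Finset.smul_sum]
  rw [MeasureTheory.integral_finsetSum]
  · refine Finset.sum_congr rfl fun i _ => ?_
    rw [← MeasureTheory.integral_const_mul]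
    congr 1
    ext v
    simp only [smul_eq_mul]
    ring
  · intro i hi
    simpa only [smul_eq_mul] using integrable_exp_smul ((hg i hi).const_mul (c i)) ξ

theorem fourier_mul_exp (g : ℝ → ℂ) (ν ξ : ℝ) :
    𝓕 (fun x : ℝ => Complex.exp (2 * Real.pi * Complex.I * ν * x) * g x) ξ = 𝓕 g (ξ - ν) := by
  simp only [Real.fourier_real_eq_integral_exp_smul, smul_eq_mul]
  congr 1
  ext v
  rw [← mul_assoc, ← Complex.exp_add]
  congr 2
  push_cast
  ring

theorem iteratedDeriv_ofReal_mul {g : ℝ → ℂ} (hg : ContDiff ℝ ∞ g) (n : ℕ) (x : ℝ) :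
    iteratedDeriv n (fun x : ℝ => (x : ℂ) * g x) x =
      x * iteratedDeriv n g x + n * iteratedDeriv (n - 1) g x := by
  induction n generalizing x with
  | zero => simp
  | succ n ih =>
    have hd : ∀ k x, HasDerivAt (iteratedDeriv k g) (iteratedDeriv (k + 1) g x) x := fun k x => by
      rw [iteratedDeriv_succ]
      exact ((hg.differentiable_iteratedDeriv k (by exact_mod_cast WithTop.coe_lt_top _))
        x).hasDerivAt
    rw [iteratedDeriv_succ, funext ih]
    have h1 : HasDerivAt (fun x : ℝ => (x : ℂ) * iteratedDeriv n g x)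
        (1 * iteratedDeriv n g x + x * iteratedDeriv (n + 1) g x) x :=
      (HasDerivAt.ofReal_comp (hasDerivAt_id x)).mul (hd n x) |>.congr_deriv (by simp)
    have h2 : HasDerivAt (fun x : ℝ => (n : ℂ) * iteratedDeriv (n - 1) g x)
        (n * iteratedDeriv n g x) x := by
      rcases n with _ | n
      · simpa using hasDerivAt_const x (0:ℂ)
      · exact (hd n x).const_mul _
    rw [(h1.fun_add h2).deriv]
    push_cast
    ring

/-- By Leibniz, each factor `x` contributes `R` from the undifferentiated factor and `n b ^ (n - 1)
≤ (m / b) b ^ n` from the differentiated one. -/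
theorem norm_iteratedDeriv_pow_mul_le {g : ℝ → ℂ} (hg : ContDiff ℝ ∞ g) {R B b : ℝ} {m : ℕ}
    (hR : 0 ≤ R) (hb : 0 < b) (hB : 0 ≤ B) (hz : ∀ x, R < |x| → g x = 0)
    (hd : ∀ n ≤ m, ∀ x, ‖iteratedDeriv n g x‖ ≤ B * b ^ n) (k : ℕ) :
    ∀ n ≤ m, ∀ x, ‖iteratedDeriv n (fun x : ℝ => (x : ℂ) ^ k * g x) x‖ ≤
      B * (R + m / b) ^ k * b ^ n := by
  induction k with
  | zero => simpa using hd
  | succ k ih =>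
    intro n hn x
    have hs : ContDiff ℝ ∞ (fun x : ℝ => (x : ℂ) ^ k * g x) :=
      (Complex.ofRealCLM.contDiff.pow k).mul hg
    have heq : (fun x : ℝ => (x : ℂ) ^ (k + 1) * g x) =
        fun x : ℝ => (x : ℂ) * ((x : ℂ) ^ k * g x) := by
      funext x; ring
    rcases lt_or_ge R |x| with hx | hx
    · rw [iteratedDeriv_eq_zero_of_lt (R := R) (fun y hy => by rw [hz y hy, mul_zero]) n hx, norm_zero]
      positivity
    · rw [heq, iteratedDeriv_ofReal_mul hs]
      set E := B * (R + m / b) ^ k with hE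
      have hE0 : 0 ≤ E := by positivity
      calc _ ≤ |x| * ‖iteratedDeriv n (fun x : ℝ => (x : ℂ) ^ k * g x) x‖ +
            n * ‖iteratedDeriv (n - 1) (fun x : ℝ => (x : ℂ) ^ k * g x) x‖ := by
            refine (norm_add_le _ _).trans (le_of_eq ?_)
            simp
        _ ≤ R * (E * b ^ n) + m / b * (E * b ^ n) := by
            refine add_le_add (mul_le_mul hx (ih n hn x) (norm_nonneg _) hR) ?_
            rcases n with _ | n
            · simp only [Nat.cast_zero, zero_mul]; positivity
            · have h1 := ih n (by omega) x
              have h2 : ((n + 1 : ℕ) : ℝ) ≤ m := by exact_mod_cast hn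
              simp only [Nat.add_sub_cancel]
              calc _ ≤ (m:ℝ) * (E * b ^ n) := by gcongr
                _ = m / b * (E * b ^ (n + 1)) := by field_simp; ring
        _ = B * (R + m / b) ^ (k + 1) * b ^ n := by rw [hE]; ring

theorem norm_fourier_le_of_iteratedDeriv {g : ℝ → ℂ} (hg : ContDiff ℝ ∞ g) {R B : ℝ} {m : ℕ}
    (hR : 0 ≤ R) (hz : ∀ x, R < |x| → g x = 0) (hd : ∀ x, ‖iteratedDeriv m g x‖ ≤ B) (η : ℝ) :
    (2 * Real.pi * |η|) ^ m * ‖𝓕 g η‖ ≤ 2 * R * B := by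
  have h := congrFun (Real.fourier_iteratedDeriv (N := ⊤) (n := m) (f := g) hg
    (fun n _ => integrable_of_zero_of_lt
      (hg.continuous_iteratedDeriv n (by exact_mod_cast le_top))
      fun x hx => iteratedDeriv_eq_zero_of_lt hz n hx) le_top) η
  have h2 := norm_fourier_le hR (fun x hx => iteratedDeriv_eq_zero_of_lt hz m hx) hd η
  rw [h] at h2
  simpa [norm_smul, abs_of_pos Real.pi_pos] using h2

/-! ### Windowed trigonometric polynomials outside the frequency band -/

/-- The trigonometric polynomial with coefficients `c n`, `|n| ≤ N`, and period `2 R`. -/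
noncomputable def trigPoly (N : ℕ) (R : ℝ) (c : ℤ → ℂ) (x : ℝ) : ℂ :=
  ∑ n ∈ Finset.Icc (-N : ℤ) N,
    c n * Complex.exp (2 * Real.pi * Complex.I * ((n / (2 * R) : ℝ) : ℂ) * x)

theorem contDiff_trigPoly (N : ℕ) (R : ℝ) (c : ℤ → ℂ) : ContDiff ℝ ∞ (trigPoly N R c) := by
  unfold trigPoly
  refine ContDiff.sum fun n _ => contDiff_const.mul ?_
  exact (contDiff_const.mul Complex.ofRealCLM.contDiff).cexp

theorem norm_exp_two_pi_I_mul (ν x : ℝ) :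
    ‖Complex.exp (2 * Real.pi * Complex.I * ν * x)‖ = 1 := by
  rw [show (2 * Real.pi * Complex.I * ν * x : ℂ) = ((2 * Real.pi * ν * x : ℝ) : ℂ) * Complex.I by
    push_cast; ring, Complex.norm_exp_ofReal_mul_I]

theorem norm_trigPoly_le {N : ℕ} {R γ : ℝ} {c : ℤ → ℂ} (hc : ∀ n, |n| ≤ (N:ℤ) → ‖c n‖ ≤ γ) (x : ℝ) :
    ‖trigPoly N R c x‖ ≤ (2 * N + 1) * γ := by
  unfold trigPoly
  refine (norm_sum_le_of_le _ (f := fun n : ℤ => _) (n := fun _ => γ) fun n hn => ?_).trans ?_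
  · rw [norm_mul, norm_exp_two_pi_I_mul, mul_one]
    exact hc n (abs_le.2 (Finset.mem_Icc.1 hn))
  · rw [Finset.sum_const, Int.card_Icc, nsmul_eq_mul]
    apply le_of_eq
    congr 1
    have : ((N:ℤ) + 1 - -N).toNat = 2 * N + 1 := by omega
    rw [this]; push_cast; ring

/-- Away from the frequencies of the trigonometric polynomial, the Fourier transform of its product
with a window is small. -/
theorem IsWindow.norm_fourier_le_far {R c₀ ρ b γ R₂ ξ : ℝ} {m N A : ℕ} {χ : ℝ → ℂ} {c : ℤ → ℂ}
    (hχ : IsWindow R m c₀ ρ b χ) (hR : 0 < R) (hm : 0 < m) (hAm : A ≤ m) (hN : N ≤ 2 * R * R₂)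
    (hR₂ : 0 ≤ R₂)
    (hc : ∀ n, |n| ≤ (N:ℤ) → ‖c n‖ ≤ γ) (hγ : 0 ≤ γ) (hξ : R₂ + b ≤ |ξ|) (k : ℕ) :
    ‖𝓕 (fun x : ℝ => (x:ℂ) ^ k * (χ x * trigPoly N R c x)) ξ‖ ≤
      (2 * N + 1) * γ * (6 * R * (2 * R) ^ k) * (1 / 2) ^ m * ((b + R₂) / |ξ|) ^ A := by
  have hb : 0 < b := lt_of_lt_of_le (by positivity) hχ.le_b
  have hξ0 : 0 < |ξ| := by linarith
  have hmb : (m:ℝ) / b ≤ R := by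
    have := hχ.le_b
    rw [div_le_iff₀ hR] at this
    rw [div_le_iff₀ hb]
    have : (0:ℝ) ≤ m := by positivity
    linarith
  set g : ℝ → ℂ := fun x => (x:ℂ) ^ k * χ x with hg
  have hgs : ContDiff ℝ ∞ g := (Complex.ofRealCLM.contDiff.pow k).mul hχ.smooth
  have hgz : ∀ x, R < |x| → g x = 0 := fun x hx => by simp [hg, hχ.zero_of_lt x hx]
  have hgd : ∀ x, ‖iteratedDeriv m g x‖ ≤ 3 * (2 * R) ^ k * b ^ m := fun x => by
    refine (norm_iteratedDeriv_pow_mul_le hχ.smooth hR.le hb (by norm_num) hχ.zero_of_lt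
      hχ.deriv_le k m le_rfl x).trans ?_
    gcongr
    linarith
  -- The `m` derivatives yield `(1 / (2π)) ^ m (b / |η|) ^ m`. The first factor gives the
  -- exponential gain, and only `A` powers of the second are kept for decay in `ξ`. The two lower
  -- bounds on `|η|` give `b / |η| ≤ (b + R₂) / |ξ|`.
  have hfar : ∀ η, b ≤ |η| → |ξ| - R₂ ≤ |η| →
      ‖𝓕 g η‖ ≤ 6 * R * (2 * R) ^ k * (1 / 2) ^ m * ((b + R₂) / |ξ|) ^ A := by
    intro η hη hη'
    have hη0 : 0 < |η| := hb.trans_le hη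
    have h := norm_fourier_le_of_iteratedDeriv hgs hR.le hgz hgd η
    have hp : (0:ℝ) < (2 * Real.pi * |η|) ^ m := by positivity
    rw [← le_div_iff₀' hp] at h
    refine h.trans ?_
    have e : 2 * R * (3 * (2 * R) ^ k * b ^ m) / (2 * Real.pi * |η|) ^ m =
      6 * R * (2 * R) ^ k * ((1 / (2 * Real.pi)) ^ m * (b / |η|) ^ m) := by
      rw [← mul_pow, one_div, ← div_eq_inv_mul, div_div, mul_comm |η|, div_pow]
      ring
    rw [e, mul_assoc _ ((1 / 2 : ℝ) ^ m)]
    have hle1 : b / |η| ≤ 1 := (div_le_one hη0).2 hη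
    have h1 : (b / |η|) ^ m ≤ ((b + R₂) / |ξ|) ^ A := by
      refine (pow_le_pow_of_le_one (by positivity) hle1 hAm).trans ?_
      gcongr ?_ ^ _
      rw [div_le_div_iff₀ hη0 hξ0]
      nlinarith
    gcongr
    linarith [Real.pi_gt_three]
  have heq : (fun x : ℝ => (x:ℂ) ^ k * (χ x * trigPoly N R c x)) = fun x : ℝ =>
      ∑ n ∈ Finset.Icc (-N : ℤ) N, c n *
        (Complex.exp (2 * Real.pi * Complex.I * ((n / (2 * R) : ℝ) : ℂ) * x) * g x) := by
    funext x
    simp only [trigPoly, hg, Finset.mul_sum]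
    exact Finset.sum_congr rfl fun n _ => by ring
  rw [heq, fourier_finset_sum_mul]
  · simp only [fourier_mul_exp]
    refine (norm_sum_le_of_le _ (n := fun _ => γ *
      (6 * R * (2 * R) ^ k * (1 / 2) ^ m * ((b + R₂) / |ξ|) ^ A)) fun n hn => ?_).trans ?_
    · rw [norm_mul]
      have hn' := Finset.mem_Icc.1 hn
      have hν : |(n:ℝ) / (2 * R)| ≤ R₂ := by
        rw [abs_div, abs_of_pos (by positivity : 0 < 2 * R), div_le_iff₀ (by positivity)]
        have : |(n:ℝ)| ≤ N := by
          rw [abs_le]; constructor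
          · exact_mod_cast hn'.1
          · exact_mod_cast hn'.2
        linarith
      have := abs_sub_abs_le_abs_sub ξ (n / (2 * R))
      exact mul_le_mul (hc n (abs_le.2 hn')) (hfar _ (by linarith) (by linarith)) (norm_nonneg _) hγ
    · rw [Finset.sum_const, Int.card_Icc, nsmul_eq_mul]
      have : ((N:ℤ) + 1 - -N).toNat = 2 * N + 1 := by omega
      rw [this]; push_cast
      apply le_of_eq; ring
  · intro n _
    refine integrable_of_zero_of_lt (R := R) ?_ fun x hx => by rw [hgz x hx, mul_zero]
    exact (by fun_prop : Continuous _).mul hgs.continuous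

/-- Recentring moments at `c₀` lets the exponential be expanded about the centre of a window, where
`|x - c₀| ≤ ρ` even if `R` is much larger. The induction writes one factor `x - c₀` as a difference.
-/
theorem fourier_sub_pow_mul_pow_mul_eq_zero {u : ℝ → ℂ} (hu : Continuous u) {R : ℝ}
    (hz : ∀ x, R < |x| → u x = 0) {Q : ℕ} {ξ₀ : ℝ}
    (hmom : ∀ n < Q, 𝓕 (fun x : ℝ => (x:ℂ) ^ n * u x) ξ₀ = 0) (c₀ : ℂ) (l : ℕ) :
    ∀ k, k + l < Q → 𝓕 (fun x : ℝ => (x - c₀) ^ l * ((x:ℂ) ^ k * u x)) ξ₀ = 0 := by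
  have hint : ∀ l k : ℕ, MeasureTheory.Integrable
      (fun x : ℝ => (x - c₀) ^ l * ((x:ℂ) ^ k * u x)) := fun l k => by
    refine integrable_of_zero_of_lt (R := R) (by fun_prop) fun x hx => by rw [hz x hx]; simp
  induction l with
  | zero => intro k hk; simpa using hmom k hk
  | succ l ih =>
    intro k hk
    have heq : (fun x : ℝ => (x - c₀) ^ (l + 1) * ((x:ℂ) ^ k * u x)) = fun x : ℝ =>
        ∑ i : Bool, (if i then 1 else -c₀) *
          ((x - c₀) ^ l * ((x:ℂ) ^ (if i then k + 1 else k) * u x)) := by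
      funext x
      simp only [Fintype.sum_bool, if_true, Bool.false_eq_true, if_false]
      ring
    rw [heq, fourier_finset_sum_mul Finset.univ (fun i : Bool => if i then (1:ℂ) else -c₀)
      (g := fun i x => (x - c₀) ^ l * ((x:ℂ) ^ (if i then k + 1 else k) * u x))
      (fun i _ => hint _ _)]
    refine Finset.sum_eq_zero fun i _ => ?_
    rw [ih _ (by split_ifs <;> omega), mul_zero]

/-- If many moments vanish at the frequency `ξ₀`, the Fourier transform is small near `ξ₀`. -/
theorem norm_fourier_le_of_moments {u : ℝ → ℂ} (hu : Continuous u) {R B c₀ ρ b : ℝ} (hR : 0 ≤ R)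
    (hb : 0 ≤ b) (hB : 0 ≤ B)
    (hz : ∀ x, R < |x| → u x = 0) (hz' : ∀ x, ρ < |x - c₀| → u x = 0) (huB : ∀ x, ‖u x‖ ≤ B)
    {q k : ℕ} {ξ₀ : ℝ} (hmom : ∀ n < q + k, 𝓕 (fun x : ℝ => (x:ℂ) ^ n * u x) ξ₀ = 0)
    (hq : 64 * (ρ * b) ≤ q) {ξ : ℝ} (hξ : |ξ - ξ₀| ≤ b) :
    ‖𝓕 (fun x : ℝ => (x:ℂ) ^ k * u x) ξ‖ ≤ 2 * R * (R ^ k * B * (2 * (1 / 2) ^ q)) := by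
  set δ : ℝ := ξ - ξ₀
  set z : ℝ → ℂ := fun x => (-2 * Real.pi * Complex.I * δ) * (x - c₀) with hzdef
  -- The Taylor polynomial of the exponential that shifts frequency `ξ₀` to `ξ`. The vanishing
  -- moments kill its contribution, so only the remainder is integrated.
  set T : ℝ → ℂ := fun x => ∑ l ∈ Finset.range q, z x ^ l / l.factorial with hT
  have hzc : Continuous z := by simp only [hzdef]; fun_prop
  have hTc : Continuous T := by
    simp only [hT]; exact continuous_finsetSum _ fun l _ => (hzc.pow l).div_const _
  have hT0 : 𝓕 (fun x : ℝ => T x * ((x:ℂ) ^ k * u x)) ξ₀ = 0 := by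
    have heq : (fun x : ℝ => T x * ((x:ℂ) ^ k * u x)) = fun x : ℝ =>
        ∑ l ∈ Finset.range q, ((-2 * Real.pi * Complex.I * δ) ^ l / l.factorial) *
          ((x - c₀) ^ l * ((x:ℂ) ^ k * u x)) := by
      funext x
      simp only [hT, hzdef, Finset.sum_mul]
      exact Finset.sum_congr rfl fun l _ => by rw [mul_pow]; ring
    rw [heq, fourier_finset_sum_mul]
    · refine Finset.sum_eq_zero fun l hl => ?_
      rw [fourier_sub_pow_mul_pow_mul_eq_zero hu hz hmom c₀ l k
        (by have := Finset.mem_range.1 hl; omega), mul_zero]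
    · exact fun l _ => integrable_of_zero_of_lt (R := R) (by fun_prop)
        fun x hx => by rw [hz x hx]; simp
  have hsplit : 𝓕 (fun x : ℝ => (x:ℂ) ^ k * u x) ξ =
      Complex.exp (-2 * Real.pi * Complex.I * δ * c₀) *
        𝓕 (fun x : ℝ => (Complex.exp (z x) - T x) * ((x:ℂ) ^ k * u x)) ξ₀ := by
    have heq : (fun x : ℝ => (Complex.exp (z x) - T x) * ((x:ℂ) ^ k * u x)) = fun x : ℝ =>
        ∑ i : Bool, (if i then 1 else -1) *
          ((if i then Complex.exp (z x) else T x) * ((x:ℂ) ^ k * u x)) := by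
      funext x
      simp only [Fintype.sum_bool, if_true, Bool.false_eq_true, if_false]
      ring
    rw [heq, fourier_finset_sum_mul Finset.univ (fun i : Bool => if i then (1:ℂ) else -1)
      (g := fun i x => (if i then Complex.exp (z x) else T x) * ((x:ℂ) ^ k * u x))]
    · simp only [Fintype.sum_bool, if_true, Bool.false_eq_true, if_false, hT0]
      simp only [Real.fourier_real_eq_integral_exp_smul, smul_eq_mul, one_mul, mul_zero, add_zero]
      rw [← MeasureTheory.integral_const_mul]
      congr 1
      ext v
      simp only [← mul_assoc, ← Complex.exp_add]
      congr 3
      simp only [hzdef, δ]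
      push_cast
      ring
    · intro i _
      refine integrable_of_zero_of_lt (R := R) ?_ fun x hx => by rw [hz x hx]; simp
      cases i
      · simp only [Bool.false_eq_true, if_false]; fun_prop
      · simp only [if_true]; fun_prop
  rw [hsplit, norm_mul]
  have h1 : ‖Complex.exp (-2 * Real.pi * Complex.I * δ * c₀)‖ = 1 := by
    rw [show (-2 * Real.pi * Complex.I * δ * c₀ : ℂ) =
      ((-2 * Real.pi * δ * c₀ : ℝ) : ℂ) * Complex.I by push_cast; ring,
      Complex.norm_exp_ofReal_mul_I]
  rw [h1, one_mul]
  refine norm_fourier_le hR (fun x hx => by rw [hz x hx]; simp) (fun x => ?_) ξ₀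
  rcases lt_or_ge R |x| with hx | hx
  · rw [hz x hx]; simp only [mul_zero, norm_zero]; positivity
  rcases lt_or_ge ρ |x - c₀| with hx' | hx'
  · rw [hz' x hx']; simp only [mul_zero, norm_zero]; positivity
  -- Here `2π |δ| |x - c₀| ≤ 8 ρ b ≤ q / 8`. The remainder is then at most `2 (q / 8) ^ q / q! ≤ 2
  -- (e / 8) ^ q`, and `e < 4` gives `2 (1 / 2) ^ q`.
  have hzx : ‖z x‖ ≤ q / 8 := by
    have : ‖z x‖ = 2 * Real.pi * |δ| * |x - c₀| := by
      simp only [hzdef]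
      rw [show (-2 * Real.pi * Complex.I * δ) * ((x:ℂ) - c₀) =
        ((-2 * Real.pi * δ * (x - c₀) : ℝ) : ℂ) * Complex.I by push_cast; ring]
      rw [norm_mul, Complex.norm_I, mul_one, Complex.norm_real]
      simp [abs_of_pos Real.pi_pos]
    rw [this]
    have h3 : |δ| * |x - c₀| ≤ b * ρ := mul_le_mul hξ hx' (abs_nonneg _) hb
    have h4 : 0 ≤ |δ| * |x - c₀| := by positivity
    nlinarith [Real.pi_lt_four]
  have hexp : ‖Complex.exp (z x) - T x‖ ≤ 2 * (1 / 2) ^ q := by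
    refine (Complex.exp_bound' (n := q) ?_).trans ?_
    · rw [div_le_iff₀ (by positivity)]
      push_cast
      linarith [norm_nonneg (z x), (by positivity : (0:ℝ) ≤ q)]
    · rw [mul_comm]
      gcongr
      have he := Real.pow_div_factorial_le_exp (x := q) (by positivity) q
      have he4 : Real.exp q ≤ 4 ^ q := by
        rw [← Real.exp_one_pow]
        gcongr
        linarith [Real.exp_one_lt_d9]
      calc ‖z x‖ ^ q / q.factorial ≤ (q / 8) ^ q / q.factorial := by gcongr
        _ = (1 / 8) ^ q * ((q:ℝ) ^ q / q.factorial) := by rw [div_pow, one_div, inv_pow]; ring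
        _ ≤ (1 / 8) ^ q * 4 ^ q := by gcongr; exact he.trans he4
        _ = (1 / 2) ^ q := by rw [← mul_pow]; norm_num
  rw [norm_mul, norm_mul, norm_pow, Complex.norm_real, Real.norm_eq_abs]
  calc _ ≤ (2 * (1 / 2) ^ q) * (R ^ k * B) := by
        gcongr
        exact huB x
    _ = _ := by ring

/-- The product of a window and a trigonometric polynomial with many vanishing moments at the
frequencies `± R₂` has small Fourier transform off `[-R₂, R₂]`. -/
theorem IsWindow.norm_fourier_le {R c₀ ρ b γ R₂ ξ : ℝ} {m N A L q : ℕ} {χ : ℝ → ℂ} {c : ℤ → ℂ}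
    (hχ : IsWindow R m c₀ ρ b χ) (hR : 0 < R) (hm : 0 < m) (hAm : A ≤ m) (hN : N ≤ 2 * R * R₂)
    (hR₂ : 0 < R₂) (hc : ∀ n, |n| ≤ (N:ℤ) → ‖c n‖ ≤ γ) (hγ : 0 ≤ γ) (hq : 512 * m ≤ q)
    (hmom : ∀ n < q + L, ∀ σ : Bool,
      𝓕 (fun x : ℝ => (x:ℂ) ^ n * (χ x * trigPoly N R c x)) (if σ then R₂ else -R₂) = 0)
    {k : ℕ} (hk : k ≤ L) (hξ : R₂ ≤ |ξ|) :
    ‖𝓕 (fun x : ℝ => (x:ℂ) ^ k * (χ x * trigPoly N R c x)) ξ‖ ≤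
      (2 * N + 1) * γ * (12 * R * (2 * R) ^ k) * (1 / 2) ^ m * ((b + R₂) / |ξ|) ^ A := by
  have hb : 0 < b := lt_of_lt_of_le (by positivity) hχ.le_b
  have hξ0 : 0 < |ξ| := by linarith
  rcases le_or_gt (R₂ + b) |ξ| with h | h
  · refine (hχ.norm_fourier_le_far hR hm hAm hN hR₂.le hc hγ h k).trans ?_
    gcongr
    norm_num
  have hnear : ∀ σ : Bool, |ξ - (if σ then R₂ else -R₂)| ≤ b →
      ‖𝓕 (fun x : ℝ => (x:ℂ) ^ k * (χ x * trigPoly N R c x)) ξ‖ ≤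
        2 * R * (R ^ k * (3 * ((2 * N + 1) * γ)) * (2 * (1 / 2) ^ q)) := fun σ hσ => by
    refine norm_fourier_le_of_moments (u := fun x => χ x * trigPoly N R c x) (hχ.smooth.continuous.mul (contDiff_trigPoly N R c).continuous)
      hR.le hb.le (by positivity) (fun x hx => by rw [hχ.zero_of_lt x hx, zero_mul])
      (fun x hx => by rw [hχ.zero_far x hx, zero_mul]) (fun x => ?_)
      (fun n hn => hmom n (by omega) σ) ?_ hσ
    · rw [norm_mul]
      refine mul_le_mul ?_ (norm_trigPoly_le hc x) (norm_nonneg _) (by norm_num)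
      simpa using hχ.deriv_le 0 (by omega) x
    · have := hχ.radius_mul_le
      have : (512 * m : ℝ) ≤ q := by exact_mod_cast hq
      linarith
  have hle : ‖𝓕 (fun x : ℝ => (x:ℂ) ^ k * (χ x * trigPoly N R c x)) ξ‖ ≤
        2 * R * (R ^ k * (3 * ((2 * N + 1) * γ)) * (2 * (1 / 2) ^ q)) := by
    rcases le_or_gt 0 ξ with h0 | h0
    · refine hnear true ?_
      rw [abs_of_nonneg h0] at h hξ
      simp only [if_true]
      rw [abs_of_nonneg (by linarith)]
      linarith
    · refine hnear false ?_
      rw [abs_of_neg h0] at h hξ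
      simp only [Bool.false_eq_true, if_false]
      rw [abs_of_nonpos (by linarith)]
      linarith
  refine hle.trans ?_
  -- Within distance `b` of the band the decay factor is at least 1, so the near bound also fits the
  -- far form.
  have h1 : (1:ℝ) ≤ ((b + R₂) / |ξ|) ^ A := by
    refine one_le_pow₀ ?_
    rw [le_div_iff₀ hξ0]
    linarith
  have h2 : ((1:ℝ) / 2) ^ q ≤ (1 / 2) ^ m :=
    pow_le_pow_of_le_one (by norm_num) (by norm_num) (by omega)
  have h3 : R ^ k ≤ (2 * R) ^ k := by gcongr; linarith
  calc 2 * R * (R ^ k * (3 * ((2 * N + 1) * γ)) * (2 * (1 / 2) ^ q))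
      ≤ 2 * R * ((2 * R) ^ k * (3 * ((2 * N + 1) * γ)) * (2 * (1 / 2) ^ m)) := by gcongr
    _ = (2 * N + 1) * γ * (12 * R * (2 * R) ^ k) * (1 / 2) ^ m * 1 := by ring
    _ ≤ _ := by gcongr

theorem iteratedDeriv_fourier_eq {f : ℝ → ℂ} (hf : Continuous f) {R : ℝ}
    (hz : ∀ x, R < |x| → f x = 0) (k : ℕ) (ξ : ℝ) :
    iteratedDeriv k (𝓕 f) ξ =
      (-2 * Real.pi * Complex.I) ^ k * 𝓕 (fun x : ℝ => (x:ℂ) ^ k * f x) ξ := by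
  have hi : ∀ n : ℕ, MeasureTheory.Integrable (fun x : ℝ => (x:ℂ) ^ n * f x) := fun n =>
    integrable_of_zero_of_lt (R := R) (by fun_prop) fun x hx => by rw [hz x hx, mul_zero]
  rw [Real.iteratedDeriv_fourier (N := ⊤) (n := k) (fun n _ => ?_) le_top]
  · have := fourier_finset_sum_mul Finset.univ (fun _ : Unit => (-2 * Real.pi * Complex.I) ^ k)
      (g := fun _ x => (x:ℂ) ^ k * f x) (fun _ _ => hi k) ξ
    simp only [Finset.univ_unique, Finset.sum_singleton] at this
    rw [← this]
    have e : (fun x : ℝ => (-2 * Real.pi * Complex.I * x) ^ k • f x) =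
        fun x : ℝ => (-2 * Real.pi * Complex.I) ^ k * ((x:ℂ) ^ k * f x) := by
      funext x
      simp only [smul_eq_mul, mul_pow]
      ring
    rw [e]
  · convert hi n using 2 with x
    simp [Complex.real_smul]

/-! ### Coefficients bounded by values -/

/-- The coefficients of a trigonometric polynomial are bounded by its values at interior points of
its period. -/
theorem exists_norm_coeff_le_trigPoly {N : ℕ} {R : ℝ} (hR : 0 < R) (c : ℤ → ℂ) {n : ℤ}
    (hn : |n| ≤ (N:ℤ)) :
    ∃ x, |x| ≤ R - R / (2 * N + 1) ∧ ‖c n‖ ≤ ‖trigPoly N R c x‖ := by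
  set P : ℕ := 2 * N + 1 with hP
  have hP0 : (0:ℝ) < P := by positivity
  have hPc : (P:ℂ) ≠ 0 := by exact_mod_cast hP0.ne'
  have hRc : (R:ℂ) ≠ 0 := by exact_mod_cast hR.ne'
  -- Midpoints of `P = 2 N + 1` equal subintervals of `[-R, R]`: they stay `R / P` away from the
  -- ends, and the frequencies are orthogonal on them.
  set y : ℕ → ℝ := fun s => -R + (2 * s + 1) * R / P with hy
  have hyle : ∀ s < P, |y s| ≤ R - R / (2 * N + 1) := by
    intro s hs
    have hs' : (s:ℝ) + 1 ≤ P := by exact_mod_cast hs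
    have e : R / (2 * N + 1) = R / P := by rw [hP]; push_cast; rfl
    rw [e, abs_le]
    constructor
    · have : 0 ≤ 2 * s * R / P := by positivity
      have e2 : (2 * s + 1) * R / P = 2 * s * R / P + R / P := by ring
      simp only [hy]; linarith
    · have e2 : (2 * s + 1) * R / P + R / P = (2 * s + 2) * R / P := by ring
      have : (2 * s + 2) * R / P ≤ 2 * R := by
        rw [div_le_iff₀ hP0]; nlinarith
      simp only [hy]; linarith
  have horth : ∀ l : ℤ, |l| ≤ (N:ℤ) →
      ∑ s ∈ Finset.range P, Complex.exp (2 * Real.pi * Complex.I * ((l / (2 * R) : ℝ) : ℂ) * y s) *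
        Complex.exp (-(2 * Real.pi * Complex.I * ((n / (2 * R) : ℝ) : ℂ) * y s)) =
      if l = n then (P:ℂ) else 0 := by
    intro l hl
    split_ifs with hln
    · subst hln
      rw [Finset.sum_congr rfl (g := fun _ => (1:ℂ))]
      · simp
      · intro s _
        rw [← Complex.exp_add, add_neg_cancel, Complex.exp_zero]
    · set ζ : ℂ := Complex.exp (2 * Real.pi * Complex.I * ((l - n : ℤ) : ℂ) / P) with hζ
      set D : ℂ := Complex.exp (Real.pi * Complex.I * ((l - n : ℤ) : ℂ) * (-1 + 1 / P)) with hD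
      have hterm : ∀ s : ℕ,
          Complex.exp (2 * Real.pi * Complex.I * ((l / (2 * R) : ℝ) : ℂ) * y s) *
          Complex.exp (-(2 * Real.pi * Complex.I * ((n / (2 * R) : ℝ) : ℂ) * y s)) = D * ζ ^ s := by
        intro s
        rw [← Complex.exp_add, hζ, hD, ← Complex.exp_nat_mul, ← Complex.exp_add]
        congr 1
        simp only [hy]
        push_cast
        field_simp
        ring
      have hζP : ζ ^ P = 1 := by
        rw [hζ, ← Complex.exp_nat_mul, Complex.exp_eq_one_iff]
        exact ⟨l - n, by field_simp⟩
      have hζ1 : ζ ≠ 1 := by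
        rw [hζ, Ne, Complex.exp_eq_one_iff]
        rintro ⟨a, ha⟩
        have h2 : ((l - n : ℤ) : ℂ) = a * P := by
          have hpi : (2 * Real.pi * Complex.I : ℂ) ≠ 0 := Complex.two_pi_I_ne_zero
          rw [div_eq_iff hPc] at ha
          apply mul_left_cancel₀ hpi
          rw [ha]; ring
        have h3 : l - n = a * P := by exact_mod_cast h2
        have ha0 : a ≠ 0 := by
          rintro rfl
          simp only [zero_mul] at h3
          exact hln (by linarith)
        -- Distinct frequencies differ by at most `2 N < P`, so the ratio `ζ` is a nontrivial `P`-th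
        -- root of unity.
        have h4 : |l - n| ≤ 2 * N := (abs_sub l n).trans (by linarith)
        rw [h3, abs_mul] at h4
        have h5 : 1 ≤ |a| := Int.one_le_abs ha0
        have h6 : |(P:ℤ)| = 2 * N + 1 := by rw [hP]; simp; positivity
        rw [h6] at h4
        nlinarith
      simp only [hterm, ← Finset.mul_sum]
      have hg := geom_sum_mul ζ P
      rw [hζP, sub_self] at hg
      rw [(mul_eq_zero.1 hg).resolve_right (sub_ne_zero.2 hζ1), mul_zero]
  have hinv : (P:ℂ) * c n = ∑ s ∈ Finset.range P, trigPoly N R c (y s) *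
      Complex.exp (-(2 * Real.pi * Complex.I * ((n / (2 * R) : ℝ) : ℂ) * y s)) := by
    simp only [trigPoly, Finset.sum_mul]
    rw [Finset.sum_comm]
    have : ∀ l ∈ Finset.Icc (-N : ℤ) N, ∑ s ∈ Finset.range P,
        c l * Complex.exp (2 * Real.pi * Complex.I * ((l / (2 * R) : ℝ) : ℂ) * y s) *
          Complex.exp (-(2 * Real.pi * Complex.I * ((n / (2 * R) : ℝ) : ℂ) * y s)) =
        if l = n then c n * (P:ℂ) else 0 := by
      intro l hl
      simp only [mul_assoc (c l), ← Finset.mul_sum]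
      rw [horth l (abs_le.2 (Finset.mem_Icc.1 hl))]
      split_ifs with h
      · rw [h]
      · rw [mul_zero]
    rw [Finset.sum_congr rfl this, Finset.sum_ite_eq', if_pos (Finset.mem_Icc.2 (abs_le.1 hn)),
      mul_comm]
  by_contra! hcon
  have hlt : ‖(P:ℂ) * c n‖ < P * ‖c n‖ := by
    rw [hinv]
    refine (norm_sum_le _ _).trans_lt ?_
    calc _ < ∑ s ∈ Finset.range P, ‖c n‖ := by
          refine Finset.sum_lt_sum_of_nonempty ⟨0, by simp [hP]⟩ fun s hs => ?_
          rw [norm_mul, ← mul_neg, ← Complex.ofReal_neg, norm_exp_two_pi_I_mul, mul_one]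
          exact hcon _ (hyle s (Finset.mem_range.1 hs))
      _ = P * ‖c n‖ := by simp
  rw [norm_mul, Complex.norm_natCast] at hlt
  exact lt_irrefl _ hlt

/-! ### Summability over `M`, and linear conditions -/

/-- Polynomial growth of the counting function makes negative powers summable. -/
theorem exists_sum_inv_pow_le {κ : Type*} {M : κ → ℝ} {L : ℝ} {l : ℕ} (hl : L ≤ l)
    (hM : ∀ᶠ R : ℝ in Filter.atTop, ((countIn M R : ℕ∞) : ℝ≥0∞) ≤ ENNReal.ofReal (R ^ L)) :
    ∃ S₀ : ℝ, ∀ s : Finset κ, (∀ j ∈ s, 1 ≤ |M j|) →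
      ∑ j ∈ s, (1 / |M j|) ^ (l + 1) ≤ S₀ := by
  obtain ⟨R₀, hR₀⟩ := Filter.eventually_atTop.1 hM
  -- Counting in the larger interval of radius `B R` makes the growth hypothesis available for every
  -- `R ≥ 1`.
  set B : ℝ := max R₀ 1 with hB
  have hB1 : 1 ≤ B := le_max_right _ _
  have hcard : ∀ R : ℝ, 1 ≤ R → ∀ s : Finset κ, (∀ j ∈ s, |M j| ≤ R) →
      (s.card : ℝ) ≤ B ^ l * R ^ l := by
    intro R hR s hs
    have hBR : B ≤ B * R := le_mul_of_one_le_right (by linarith) hR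
    have h := hR₀ (B * R) ((le_max_left _ _).trans hBR)
    have h1 : (s.card : ℕ∞) ≤ countIn M (B * R) := by
      rw [← Set.encard_coe_eq_coe_finsetCard]
      exact Set.encard_le_encard fun j hj => (hs j hj).trans
        (le_mul_of_one_le_left (by linarith) hB1)
    have h2 : ((s.card : ℕ∞) : ℝ≥0∞) ≤ ENNReal.ofReal ((B * R) ^ L) :=
      (ENat.toENNReal_le.2 h1).trans h
    rw [ENat.toENNReal_coe, ← ENNReal.ofReal_natCast,
      ENNReal.ofReal_le_ofReal_iff (by positivity)] at h2
    refine h2.trans ?_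
    rw [← mul_pow, ← Real.rpow_natCast]
    exact Real.rpow_le_rpow_of_exponent_le (hB1.trans hBR) hl
  refine ⟨B ^ l * 2 ^ l * 2, fun s hs => ?_⟩
  -- Dyadic shells: shell `i` has `O(2 ^ (i l))` points, each contributing at most `2 ^ (-i (l +
  -- 1))`, which leaves a geometric series.
  set φ : κ → ℕ := fun j => Nat.log 2 ⌊|M j|⌋₊ with hφ
  have hlow : ∀ j ∈ s, (2:ℝ) ^ φ j ≤ |M j| := fun j hj => by
    have h0 : ⌊|M j|⌋₊ ≠ 0 := (Nat.floor_pos.2 (hs j hj)).ne'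
    calc (2:ℝ) ^ φ j = ((2 ^ φ j : ℕ) : ℝ) := by push_cast; rfl
      _ ≤ (⌊|M j|⌋₊ : ℝ) := by exact_mod_cast Nat.pow_log_le_self 2 h0
      _ ≤ |M j| := Nat.floor_le (abs_nonneg _)
  have hup : ∀ j, |M j| ≤ 2 ^ (φ j + 1) := fun j => by
    have h1 := Nat.lt_pow_succ_log_self (b := 2) (by norm_num) ⌊|M j|⌋₊
    have h2 : ((⌊|M j|⌋₊ + 1 : ℕ) : ℝ) ≤ ((2 ^ (φ j + 1) : ℕ) : ℝ) := by exact_mod_cast h1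
    push_cast at h2
    exact (Nat.lt_floor_add_one _).le.trans h2
  obtain ⟨n, hn⟩ : ∃ n, ∀ j ∈ s, φ j < n :=
    ⟨s.sup φ + 1, fun j hj => Nat.lt_succ_of_le (Finset.le_sup hj)⟩
  rw [← Finset.sum_fiberwise_of_maps_to (t := Finset.range n) (g := φ)
    fun j hj => Finset.mem_range.2 (hn j hj)]
  calc _ ≤ ∑ i ∈ Finset.range n, B ^ l * 2 ^ l * (1 / 2) ^ i := by
        refine Finset.sum_le_sum fun i _ => ?_
        calc _ ≤ ∑ j ∈ s with φ j = i, (1 / (2:ℝ) ^ i) ^ (l + 1) := by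
              refine Finset.sum_le_sum fun j hj => ?_
              obtain ⟨hjs, rfl⟩ := Finset.mem_filter.1 hj
              have := hlow j hjs
              gcongr
          _ ≤ (B ^ l * (2 ^ (i + 1)) ^ l) * (1 / (2:ℝ) ^ i) ^ (l + 1) := by
              rw [Finset.sum_const, nsmul_eq_mul]
              gcongr
              refine hcard _ (one_le_pow₀ (by norm_num)) _ fun j hj => ?_
              rw [← (Finset.mem_filter.1 hj).2]
              exact hup j
          _ = B ^ l * 2 ^ l * (1 / 2) ^ i := by
              rw [pow_succ (1 / (2:ℝ) ^ i), one_div_pow, one_div_pow]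
              rw [pow_succ 2 i, mul_pow]
              field_simp
    _ ≤ B ^ l * 2 ^ l * 2 := by
        rw [← Finset.mul_sum]
        gcongr
        exact sum_geometric_two_le n

theorem exists_ne_zero_forall_eq_zero {I : Type*} [Fintype I] {D : ℕ} (hD : Fintype.card I < D)
    (Ψ : I → (Fin D → ℂ) →ₗ[ℂ] ℂ) : ∃ c : Fin D → ℂ, c ≠ 0 ∧ ∀ i, Ψ i c = 0 := by
  have h : LinearMap.ker (LinearMap.pi Ψ) ≠ ⊥ := LinearMap.ker_ne_bot_of_finrank_lt (by simpa)
  obtain ⟨c, hc, hc0⟩ := Submodule.exists_mem_ne_zero_of_ne_bot h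
  exact ⟨c, hc0, fun i => congrFun (LinearMap.mem_ker.1 hc) i⟩

theorem exists_linearMap_iteratedDeriv {χ : ℝ → ℂ} (hχ : ContDiff ℝ ∞ χ) (N : ℕ) (R : ℝ) (r : ℕ)
    (y : ℝ) : ∃ Φ : (ℤ → ℂ) →ₗ[ℂ] ℂ,
      ∀ c, Φ c = iteratedDeriv r (fun x => χ x * trigPoly N R c x) y := by
  set e : ℤ → ℝ → ℂ := fun n x =>
    χ x * Complex.exp (2 * Real.pi * Complex.I * ((n / (2 * R) : ℝ) : ℂ) * x) with he
  have hes : ∀ n, ContDiff ℝ ∞ (e n) := fun n =>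
    hχ.mul (contDiff_const.mul Complex.ofRealCLM.contDiff).cexp
  refine ⟨∑ n ∈ Finset.Icc (-N : ℤ) N, iteratedDeriv r (e n) y • LinearMap.proj n, fun c => ?_⟩
  have heq : (fun x => χ x * trigPoly N R c x) =
      fun x => ∑ n ∈ Finset.Icc (-N : ℤ) N, c n * e n x := by
    funext x
    simp only [trigPoly, he, Finset.mul_sum]
    exact Finset.sum_congr rfl fun n _ => by ring
  rw [heq, iteratedDeriv_fun_sum fun n _ =>
    ((contDiff_const.mul (hes n)).of_le (by exact_mod_cast le_top)).contDiffAt]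
  simp [mul_comm]

theorem exists_linearMap_fourier {χ : ℝ → ℂ} (hχ : Continuous χ) {R : ℝ}
    (hz : ∀ x, R < |x| → χ x = 0) (N k : ℕ) (ξ : ℝ) : ∃ Φ : (ℤ → ℂ) →ₗ[ℂ] ℂ,
      ∀ c, Φ c = 𝓕 (fun x : ℝ => (x:ℂ) ^ k * (χ x * trigPoly N R c x)) ξ := by
  set e : ℤ → ℝ → ℂ := fun n x => (x:ℂ) ^ k *
    (χ x * Complex.exp (2 * Real.pi * Complex.I * ((n / (2 * R) : ℝ) : ℂ) * x)) with he
  refine ⟨∑ n ∈ Finset.Icc (-N : ℤ) N, 𝓕 (e n) ξ • LinearMap.proj n, fun c => ?_⟩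
  have heq : (fun x : ℝ => (x:ℂ) ^ k * (χ x * trigPoly N R c x)) =
      fun x => ∑ n ∈ Finset.Icc (-N : ℤ) N, c n * e n x := by
    funext x
    simp only [trigPoly, he, Finset.mul_sum]
    exact Finset.sum_congr rfl fun n _ => by ring
  rw [heq, fourier_finset_sum_mul _ _ fun n _ => integrable_of_zero_of_lt (R := R) (by fun_prop)
    fun x hx => by simp [he, hz x hx]]
  simp [mul_comm]

/-- With `a = e + d` the factor `(2 ^ t) ^ e` is absorbed and `2 ^ (-d t) ≤ 2 ^ (-d)` remains. This
beats `a ^ A` for large `a`, uniformly in `t`. -/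
theorem exists_exponent {C : ℝ} (hC : 0 ≤ C) (A e : ℕ) : ∃ a : ℕ, A ≤ a ∧ 1 ≤ a ∧
    ∀ t : ℕ, 1 ≤ t → C * (a:ℝ) ^ A * (2 ^ t) ^ e * (1 / 2) ^ (a * t) ≤ 1 := by
  have h := (tendsto_pow_const_div_const_pow_of_one_lt A (r := (2:ℝ)) (by norm_num)).const_mul
    (C * 2 ^ e)
  rw [mul_zero] at h
  obtain ⟨a, ha1, ha⟩ := ((h.eventually_lt_const one_pos).and
    (Filter.eventually_ge_atTop (A + e + 1))).exists
  refine ⟨a, by omega, by omega, fun t ht => le_trans ?_ ha1.le⟩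
  obtain ⟨d, rfl⟩ : ∃ d, a = e + d := ⟨a - e, by omega⟩
  have e1 : ((2:ℝ) ^ t) ^ e * (1 / 2) ^ ((e + d) * t) = ((1 / 2) ^ t) ^ d := by
    rw [mul_comm (e + d), pow_mul, pow_add, ← mul_assoc, ← mul_pow, ← mul_pow]
    norm_num
  have e2 : ((1 / 2 : ℝ) ^ t) ^ d ≤ (1 / 2) ^ d := by
    gcongr
    calc ((1:ℝ) / 2) ^ t ≤ (1 / 2) ^ 1 := pow_le_pow_of_le_one (by norm_num) (by norm_num) ht
      _ = 1 / 2 := pow_one _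
  calc _ = C * ((e + d : ℕ):ℝ) ^ A * (((2:ℝ) ^ t) ^ e * (1 / 2) ^ ((e + d) * t)) := by ring
    _ ≤ C * ((e + d : ℕ):ℝ) ^ A * (1 / 2) ^ d := by rw [e1]; gcongr
    _ = _ := by rw [pow_add, one_div, inv_pow]; field_simp

/-! ### The cutoff and its moment conditions -/

/-- There is an even smooth cutoff of `[-R₁, R₁]` whose product with a trigonometric polynomial
with frequencies in `[-R₂, R₂]` has tiny Fourier transform off `[-R₂, R₂]`, as soon as the
coefficients satisfy `O(log ^ 2 (R₁ R₂))` linear equations. -/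
theorem exists_cutoff (L A E : ℕ) {ε : ℝ} (hε : 0 < ε) : ∃ C : ℕ, ∀ R₁ R₂ : ℝ, 1 < R₁ → 1 < R₂ →
    ∀ N t : ℕ, 1 ≤ t → N ≤ 2 * R₁ * R₂ → 2 * R₁ * R₂ < 2 ^ t →
    ∃ (χ : ℝ → ℂ) (I : Type) (_ : Fintype I) (Ψ : I → (ℤ → ℂ) →ₗ[ℂ] ℂ),
      Fintype.card I ≤ C * t ^ 2 ∧ ContDiff ℝ ∞ χ ∧ (∀ x, χ (-x) = χ x) ∧
      (∀ x, R₁ < |x| → χ x = 0) ∧ (∀ x, |x| ≤ R₁ - R₁ / (2 * N + 1) → χ x = 1) ∧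
      ∀ (c : ℤ → ℂ) (γ : ℝ), (∀ i, Ψ i c = 0) → 0 ≤ γ → (∀ n, |n| ≤ (N:ℤ) → ‖c n‖ ≤ γ) →
        ∀ k ≤ L, ∀ ξ, R₂ ≤ |ξ| →
          ‖iteratedDeriv k (𝓕 (fun x => χ x * trigPoly N R₁ c x)) ξ‖ ≤
            γ * (ε * (1 / 2 ^ t) ^ E * (1 / |ξ|) ^ A) := by
  set C₀ : ℝ := 7 ^ L * 96 * 2 ^ L * 9 ^ A with hC₀
  -- Powers of `2 ^ t` to be beaten: one each for the number of windows and of coefficients, `1 + L`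
  -- from `R₁`, `2 A` from `b + R₂`, and `E` for the gain claimed.
  obtain ⟨a, hAa, ha1, ha⟩ := exists_exponent (C := C₀ / ε) (by positivity) A (3 + L + 2 * A + E)
  refine ⟨10 * (512 * a + L), fun R₁ R₂ hR₁ hR₂ N t ht hN hUt => ?_⟩
  have hR : 0 < R₁ := by linarith
  set m := a * t with hm
  have hm0 : 0 < m := Nat.mul_pos ha1 ht
  -- With `t + 1` scales the transition width `R₁ / 2 ^ (t + 1)` is at most `R₁ / (2 N + 1)`, so `χ
  -- = 1` at all the sampling points.
  obtain ⟨χ, c₀, ρ, b, hw, hb, heven, hone⟩ := exists_windows hR hm0 (t + 1)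
  set U : ℝ := 2 ^ t with hU
  have htU' : t + 1 ≤ 2 ^ t := Nat.lt_two_pow_self
  have htU : (t:ℝ) + 1 ≤ U := by rw [hU]; exact_mod_cast htU'
  have ht' : (1:ℝ) ≤ t := by exact_mod_cast ht
  have hU1 : 1 ≤ U := by linarith
  have hRU : R₁ ≤ U := by nlinarith
  have hR₂U : R₂ ≤ U := by nlinarith
  have hNU : (2 * N + 1 : ℝ) ≤ 2 * U := by
    have : (N:ℝ) < (2 ^ t : ℕ) := by push_cast; exact hN.trans_lt hUt
    have h2 : N + 1 ≤ 2 ^ t := by exact_mod_cast this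
    have h3 : (N:ℝ) + 1 ≤ U := by rw [hU]; exact_mod_cast h2
    linarith
  have hχs : ∀ i, ContDiff ℝ ∞ (χ i) := fun i => (hw i).smooth
  have hlin : ∀ (i : Option (Fin (t + 1) × Bool) × Bool × Fin (512 * m + L)),
      ∃ Φ : (ℤ → ℂ) →ₗ[ℂ] ℂ, ∀ c, Φ c = 𝓕 (fun x : ℝ =>
        (x:ℂ) ^ (i.2.2 : ℕ) * (χ i.1 x * trigPoly N R₁ c x)) (if i.2.1 then R₂ else -R₂) :=
    fun i => exists_linearMap_fourier (hχs i.1).continuous (hw i.1).zero_of_lt _ _ _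
  choose Ψ hΨ using hlin
  refine ⟨fun x => ∑ i, χ i x, _, inferInstance, Ψ, ?_, ContDiff.sum fun i _ => hχs i, heven,
    fun x hx => Finset.sum_eq_zero fun i _ => (hw i).zero_of_lt x hx, ?_, ?_⟩
  · simp only [Fintype.card_prod, Fintype.card_option, Fintype.card_bool, Fintype.card_fin]
    calc ((t + 1) * 2 + 1) * (2 * (512 * m + L)) ≤ (5 * t) * (2 * ((512 * a + L) * t)) := by
          gcongr
          · omega
          · rw [add_mul, hm, mul_assoc]
            exact Nat.add_le_add_left (Nat.le_mul_of_pos_right _ ht) _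
      _ = _ := by ring
  · intro x hx
    refine hone x (hx.trans ?_)
    gcongr
    rw [pow_succ]
    linarith
  · intro c γ hc hγ hcγ k hk ξ hξ
    have hξ0 : 0 < |ξ| := by linarith
    set B : ℝ := (2 * N + 1) * γ * (12 * R₁ * (2 * R₁) ^ L) * (1 / 2) ^ m *
      (9 * a * U ^ 2 / |ξ|) ^ A with hB
    have hone_window : ∀ i, ‖𝓕 (fun x : ℝ => (x:ℂ) ^ k * (χ i x * trigPoly N R₁ c x)) ξ‖ ≤ B := by
      intro i
      refine ((hw i).norm_fourier_le hR hm0 (A := A) (L := L) (q := 512 * m) ?_ hN (by linarith)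
        hcγ hγ le_rfl ?_ hk hξ).trans ?_
      · exact hAa.trans (Nat.le_mul_of_pos_right _ ht)
      · intro n hn σ
        rw [← hΨ (i, σ, ⟨n, hn⟩) c]
        exact hc _
      · have hb0 : 0 < b i := lt_of_lt_of_le (by positivity) (hw i).le_b
        have ha1' : (1:ℝ) ≤ a := by exact_mod_cast ha1
        have hbU : b i + R₂ ≤ 9 * a * U ^ 2 := by
          have h1 : b i ≤ 4 * (a * U) * (U * 2) := by
            refine (hb i).trans ?_
            rw [div_le_iff₀ hR]
            have : (m:ℝ) ≤ a * U := by
              rw [hm]; push_cast; gcongr; linarith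
            calc 4 * (m:ℝ) * 2 ^ (t + 1) ≤ 4 * (a * U) * (U * 2) := by rw [pow_succ]; gcongr
              _ ≤ _ := le_mul_of_one_le_right (by positivity) hR₁.le
          have h2 : R₂ ≤ a * U ^ 2 := by nlinarith
          nlinarith
        rw [hB]
        gcongr
        linarith
    have hsplit : (fun x : ℝ => (x:ℂ) ^ k * ((∑ i, χ i x) * trigPoly N R₁ c x)) = fun x : ℝ =>
        ∑ i, 1 * ((x:ℂ) ^ k * (χ i x * trigPoly N R₁ c x)) := by
      funext x
      simp only [Finset.sum_mul, Finset.mul_sum, one_mul]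
    have hpc := (contDiff_trigPoly N R₁ c).continuous
    have hχc : ∀ i, Continuous (χ i) := fun i => (hχs i).continuous
    rw [iteratedDeriv_fourier_eq (R := R₁) (by fun_prop) (fun x hx => by
      beta_reduce
      rw [Finset.sum_eq_zero fun i _ => (hw i).zero_of_lt x hx, zero_mul]), norm_mul, hsplit,
      fourier_finset_sum_mul _ (fun _ => 1) fun i _ => integrable_of_zero_of_lt (R := R₁)
        (by fun_prop) fun x hx => by rw [(hw i).zero_of_lt x hx]; simp]
    have h7 : ‖(-2 * Real.pi * Complex.I : ℂ) ^ k‖ ≤ 7 ^ L := by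
      have h : ‖(-2 * Real.pi * Complex.I : ℂ)‖ ≤ 7 := by
        simp only [norm_mul, Complex.norm_I, Complex.norm_real, norm_neg, Complex.norm_ofNat,
          Real.norm_eq_abs, abs_of_pos Real.pi_pos]
        linarith [Real.pi_lt_d2]
      rw [norm_pow]
      calc _ ≤ (7:ℝ) ^ k := by gcongr
        _ ≤ 7 ^ L := pow_le_pow_right₀ (by norm_num) hk
    have hsum : ‖∑ i, 1 * 𝓕 (fun x : ℝ => (x:ℂ) ^ k * (χ i x * trigPoly N R₁ c x)) ξ‖ ≤
        4 * U * B := by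
      refine (norm_sum_le_of_le _ (n := fun _ => B) fun i _ => by
        rw [one_mul]; exact hone_window i).trans ?_
      have hB0 : 0 ≤ B := by positivity
      rw [Finset.sum_const, Finset.card_univ, nsmul_eq_mul]
      simp only [Fintype.card_prod, Fintype.card_option, Fintype.card_bool, Fintype.card_fin]
      gcongr
      push_cast
      linarith
    have hfin := ha t ht
    calc _ ≤ 7 ^ L * (4 * U * B) := mul_le_mul h7 hsum (norm_nonneg _) (by positivity)
      _ ≤ 7 ^ L * (4 * U * (2 * U * γ * (12 * U * (2 * U) ^ L) * (1 / 2) ^ m *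
          (9 * a * U ^ 2 / |ξ|) ^ A)) := by rw [hB]; gcongr
      _ = (C₀ / ε * a ^ A * U ^ (3 + L + 2 * A + E) * (1 / 2) ^ m) *
          (γ * (ε * (1 / U) ^ E * (1 / |ξ|) ^ A)) := by
          have hU0 : U ≠ 0 := by positivity
          have e1 : (9 * a * U ^ 2 / |ξ|) ^ A = 9 ^ A * a ^ A * U ^ (2 * A) * (1 / |ξ|) ^ A := by
            rw [pow_mul, ← mul_pow, ← mul_pow, ← mul_pow, mul_one_div]
          have e2 : (1 / U) ^ E * U ^ E = 1 := by rw [← mul_pow, one_div_mul_cancel hU0, one_pow]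
          have e3 : ε / ε = 1 := div_self hε.ne'
          rw [hC₀, e1, mul_pow 2 U, pow_add U, pow_add U, pow_add U]
          generalize (1 / |ξ|) ^ A = X, ((1:ℝ) / 2) ^ m = Y, (1 / U) ^ E = Z at e2 ⊢
          calc _ = (7 ^ L * 96 * 2 ^ L * 9 ^ A) * a ^ A * (U ^ 3 * U ^ L * U ^ (2 * A)) * Y * γ * X *
                (ε / ε) * (Z * U ^ E) := by rw [e2, e3]; ring
            _ = _ := by ring
      _ ≤ 1 * (γ * (ε * (1 / U) ^ E * (1 / |ξ|) ^ A)) := by gcongr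
      _ = _ := one_mul _

/-! ### The dimension bound -/

/-- An interpolation formula bounds the dimension of any space of trigonometric polynomials, with
frequencies in `[-R₂, R₂]` and in the symmetry class of the formula. -/
theorem InterpolationFormula.exists_dimension_le {ι κ : Type*} {P : (ℝ → ℂ) → Prop}
    {S : SummationFilter ι} [S.NeBot] {T : SummationFilter κ} [T.NeBot]
    {Λ : ι → ℝ} {r : ι → ℕ} {a : ι → ℝ → ℂ} {M : κ → ℝ} {k : κ → ℕ} {b : κ → ℝ → ℂ} {L : ℝ}
    (hk : ∀ j, (k j : ℝ) ≤ L)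
    (hM : ∀ᶠ R : ℝ in Filter.atTop, ((countIn M R : ℕ∞) : ℝ≥0∞) ≤ ENNReal.ofReal (R ^ L))
    (hb : ∃ (K : ℝ) (N : ℕ), ∀ (j : κ) (x : ℝ), ‖b j x‖ ≤ K * (1 + |x| + |M j|) ^ N)
    (h : InterpolationFormula P S T Λ r a M k b) :
    ∃ C : ℕ, ∀ R₁ R₂ : ℝ, 1 < R₁ → 1 < R₂ → ∀ N t : ℕ, 1 ≤ t → N ≤ 2 * R₁ * R₂ →
      2 * R₁ * R₂ < 2 ^ t → ∀ (D : ℕ) (F : (Fin D → ℂ) →ₗ[ℂ] (ℤ → ℂ)),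
      (∀ c, (∀ n, |n| ≤ (N:ℤ) → F c n = 0) → c = 0) →
      (∀ c (χ : ℝ → ℂ), (∀ x, χ (-x) = χ x) → P (fun x => χ x * trigPoly N R₁ (F c) x)) →
      (D : ℕ∞) ≤ countIn Λ R₁ + countIn M R₂ + (C * t ^ 2 : ℕ) := by
  obtain ⟨K, N₀, hb⟩ := hb
  set l := ⌈L⌉₊
  have hl : L ≤ l := Nat.le_ceil L
  obtain ⟨S₀, hS₀⟩ := exists_sum_inv_pow_le hl hM
  set ε : ℝ := 1 / (|K| * 3 ^ N₀ * |S₀| + 1) with hε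
  have hε0 : 0 < ε := by positivity
  -- Since `R₁ ≤ 2 ^ t`, `b j x` is at most `|K| (3 · 2 ^ t |M j|) ^ N₀`. The gain `E = N₀` cancels
  -- the power of `2 ^ t`, `N₀` powers of decay cancel `|M j| ^ N₀`, and the other `l + 1` make the
  -- sum converge.
  obtain ⟨C, hC⟩ := exists_cutoff l (N₀ + (l + 1)) N₀ hε0
  refine ⟨C, fun R₁ R₂ hR₁ hR₂ N t ht hN hNt D F hF hP => ?_⟩
  obtain ⟨χ, I, _, Ψ, hI, hχs, hχe, hχz, hχ1, hχ⟩ := hC R₁ R₂ hR₁ hR₂ N t ht hN hNt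
  have hR : 0 < R₁ := by linarith
  by_contra! hlt
  have hΛ : {i | |Λ i| ≤ R₁}.Finite := by
    rw [← Set.encard_lt_top_iff]
    exact ((le_self_add.trans le_self_add).trans_lt hlt).trans (ENat.natCast_lt_top _)
  have hM' : {j | |M j| ≤ R₂}.Finite := by
    rw [← Set.encard_lt_top_iff]
    exact ((le_add_self.trans le_self_add).trans_lt hlt).trans (ENat.natCast_lt_top _)
  have := hΛ.fintype
  have := hM'.fintype
  choose Φ₁ hΦ₁ using fun i : {i | |Λ i| ≤ R₁} =>
    exists_linearMap_iteratedDeriv hχs N R₁ (r i) (Λ i)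
  choose Φ₂ hΦ₂ using fun j : {j | |M j| ≤ R₂} =>
    exists_linearMap_fourier hχs.continuous hχz N (k j) (M j)
  obtain ⟨c, hc0, hc⟩ := exists_ne_zero_forall_eq_zero
    (I := ({i | |Λ i| ≤ R₁} ⊕ {j | |M j| ≤ R₂}) ⊕ I) (D := D) (by
      rw [Fintype.card_sum, Fintype.card_sum]
      simp only [countIn, Set.encard_eq_coe_toFinset_card, Set.toFinset_card] at hlt
      norm_cast at hlt
      exact lt_of_le_of_lt (Nat.add_le_add_left hI _) hlt)
    (fun i => (Sum.elim (Sum.elim Φ₁ Φ₂) Ψ i).comp F)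
  set d := F c with hd
  set f : ℝ → ℂ := fun x => χ x * trigPoly N R₁ d x with hf
  have hfs : ContDiff ℝ ∞ f := hχs.mul (contDiff_trigPoly N R₁ d)
  have hfz : ∀ x, R₁ < |x| → f x = 0 := fun x hx => by simp only [hf]; rw [hχz x hx, zero_mul]
  have hfΛ : ∀ i, iteratedDeriv (r i) f (Λ i) = 0 := by
    intro i
    rcases lt_or_ge R₁ |Λ i| with hi | hi
    · exact iteratedDeriv_eq_zero_of_lt hfz _ hi
    · rw [← hΦ₁ ⟨i, hi⟩ d]
      exact hc (Sum.inl (Sum.inl ⟨i, hi⟩))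
  have hfM : ∀ j, |M j| ≤ R₂ → iteratedDeriv (k j) (𝓕 f) (M j) = 0 := by
    intro j hj
    rw [iteratedDeriv_fourier_eq hfs.continuous hfz, ← hΦ₂ ⟨j, hj⟩ d]
    have := hc (Sum.inl (Sum.inr ⟨j, hj⟩))
    simp only [Sum.elim_inl, Sum.elim_inr, LinearMap.comp_apply] at this
    rw [this, mul_zero]
  obtain ⟨n₀, hn₀, hmax⟩ := Finset.exists_max_image (Finset.Icc (-N : ℤ) N) (fun n => ‖d n‖)
    ⟨0, by simp⟩
  set γ := ‖d n₀‖
  have hmem : ∀ n : ℤ, |n| ≤ (N:ℤ) → n ∈ Finset.Icc (-N : ℤ) N :=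
    fun n hn => Finset.mem_Icc.2 (abs_le.1 hn)
  have hγ : 0 < γ := by
    refine norm_pos_iff.2 fun h0 => hc0 (hF c fun n hn => ?_)
    have := hmax n (hmem n hn)
    exact norm_le_zero_iff.1 (this.trans_eq (norm_eq_zero.2 h0))
  have hdecay := hχ d γ (fun i => hc (Sum.inr i)) hγ.le fun n hn => hmax n (hmem n hn)
  obtain ⟨x, hx, hxγ⟩ := exists_norm_coeff_le_trigPoly hR d (abs_le.2 (Finset.mem_Icc.1 hn₀))
  have hfx : γ ≤ ‖f x‖ := by simpa only [hf, hχ1 x hx, one_mul] using hxγ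
  have hxR : |x| ≤ R₁ := hx.trans (by have : 0 ≤ R₁ / (2 * N + 1) := by positivity
                                      linarith)
  obtain ⟨u, v, hu, hv, huv⟩ := h f hfs (hasCompactSupport_of_zero_of_lt hfz) (hP c χ hχe) x
  have hu0 : u = 0 := by
    simp only [hfΛ, zero_mul] at hu
    exact hu.unique hasSum_zero
  have hterm : ∀ j, R₂ < |M j| → ‖iteratedDeriv (k j) (𝓕 f) (M j) * b j x‖ ≤
      γ * ε * |K| * 3 ^ N₀ * (1 / |M j|) ^ (l + 1) := by
    intro j hj
    have hj0 : 0 < |M j| := by linarith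
    have hkl : k j ≤ l := by exact_mod_cast (hk j).trans hl
    have hbj : ‖b j x‖ ≤ |K| * (3 * 2 ^ t * |M j|) ^ N₀ := by
      refine (hb j x).trans ?_
      refine mul_le_mul (le_abs_self K) ?_ (by positivity) (abs_nonneg _)
      gcongr
      have h1 : R₁ ≤ 2 ^ t := by nlinarith
      have h2 : R₁ * |M j| ≤ 2 ^ t * |M j| := by gcongr
      nlinarith
    rw [norm_mul]
    refine (mul_le_mul (hdecay (k j) hkl (M j) hj.le) hbj (norm_nonneg _) (by positivity)).trans
      (le_of_eq ?_)
    have e1 : ((1:ℝ) / 2 ^ t) ^ N₀ * (2 ^ t) ^ N₀ = 1 := by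
      rw [← mul_pow, one_div_mul_cancel (by positivity), one_pow]
    have e2 : (1 / |M j|) ^ N₀ * |M j| ^ N₀ = 1 := by
      rw [← mul_pow, one_div_mul_cancel hj0.ne', one_pow]
    rw [pow_add, mul_pow, mul_pow]
    calc _ = γ * ε * |K| * 3 ^ N₀ * (1 / |M j|) ^ (l + 1) *
          (((1:ℝ) / 2 ^ t) ^ N₀ * (2 ^ t) ^ N₀) * ((1 / |M j|) ^ N₀ * |M j| ^ N₀) := by ring
      _ = _ := by rw [e1, e2, mul_one, mul_one]
  have hpartial : ∀ s : Finset κ, ‖∑ j ∈ s, iteratedDeriv (k j) (𝓕 f) (M j) * b j x‖ ≤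
      γ * ε * |K| * 3 ^ N₀ * |S₀| := by
    intro s
    rw [← Finset.sum_filter_of_ne (p := fun j => R₂ < |M j|)]
    · refine (norm_sum_le_of_le _ fun j hj => hterm j (Finset.mem_filter.1 hj).2).trans ?_
      rw [← Finset.mul_sum]
      gcongr
      refine (hS₀ _ fun j hj => ?_).trans (le_abs_self _)
      linarith [(Finset.mem_filter.1 hj).2]
    · intro j _ hj
      by_contra hlt
      rw [hfM j (not_lt.1 hlt), zero_mul] at hj
      exact hj rfl
  -- All finite partial sums obey one bound, so it passes to the limit along any nontrivial
  -- summation method.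
  have hvle : ‖v‖ ≤ γ * ε * |K| * 3 ^ N₀ * |S₀| :=
    le_of_tendsto (Filter.Tendsto.norm hv) (.of_forall hpartial)
  have hvlt : γ * ε * |K| * 3 ^ N₀ * |S₀| < γ := by
    have hpos : 0 < |K| * 3 ^ N₀ * |S₀| + 1 := by positivity
    have : ε * (|K| * 3 ^ N₀ * |S₀|) < 1 := by
      rw [hε, one_div, inv_mul_lt_iff₀ hpos]; linarith
    calc _ = γ * (ε * (|K| * 3 ^ N₀ * |S₀|)) := by ring
      _ < γ * 1 := by gcongr
      _ = γ := mul_one γ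
  rw [huv, hu0, zero_add] at hfx
  linarith

/-! ### From dimension to counting functions -/

/-- A dimension bound with squared logarithmic error gives the lower bound for the counting
functions. -/
theorem CountingLowerBound.of_dimension_le {ι κ : Type*} {Λ : ι → ℝ} {M : κ → ℝ} {c : ℝ}
    (hc : 2 ≤ c) {D : ℕ → ℕ} (hD : ∀ x : ℝ, 0 ≤ x → c * x - 1 ≤ D ⌊2 * x⌋₊)
    (h : ∃ C : ℕ, ∀ R₁ R₂ : ℝ, 1 < R₁ → 1 < R₂ → ∀ N t : ℕ, 1 ≤ t → N ≤ 2 * R₁ * R₂ →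
      2 * R₁ * R₂ < 2 ^ t → N = ⌊2 * (R₁ * R₂)⌋₊ →
      (D N : ℕ∞) ≤ countIn Λ R₁ + countIn M R₂ + (C * t ^ 2 : ℕ)) :
    CountingLowerBound c Λ M := by
  obtain ⟨C, hC⟩ := h
  intro ε hε
  have hl2 : 0 < Real.log 2 := Real.log_pos (by norm_num)
  -- The 9 comes from `t ≤ 3 X`, where `X = log (c R₁ R₂) ≥ log 2`. The second summand pays for the
  -- `-1` lost in rounding.
  refine ⟨9 * C / Real.log 2 ^ ε + 1 / Real.log 2 ^ (2 + ε), by positivity, ?_⟩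
  intro R₁ R₂ hR₁ hR₂
  have hRR : 1 < R₁ * R₂ := by nlinarith
  set N := ⌊2 * (R₁ * R₂)⌋₊ with hN
  have hN2 : 2 ≤ N := Nat.le_floor (by push_cast; linarith)
  have hNle : (N:ℝ) ≤ 2 * (R₁ * R₂) := Nat.floor_le (by linarith)
  set t := Nat.log 2 N + 1 with ht
  have hNt : 2 * R₁ * R₂ < 2 ^ t := by
    have h1 : N + 1 ≤ 2 ^ t := Nat.lt_pow_succ_log_self (by norm_num) N
    have h2 : (N:ℝ) + 1 ≤ 2 ^ t := by exact_mod_cast h1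
    have := Nat.lt_floor_add_one (2 * (R₁ * R₂))
    rw [← hN] at this
    linarith
  have hmain := hC R₁ R₂ hR₁ hR₂ N t (by omega) (by linarith) hNt rfl
  generalize hn : countIn Λ R₁ + countIn M R₂ = n at hmain
  rcases eq_or_ne n ⊤ with rfl | hntop
  · simp
  lift n to ℕ using hntop
  have hmain' : (D N : ℝ) ≤ n + C * t ^ 2 := by exact_mod_cast hmain
  set X := Real.log (c * R₁ * R₂) with hX
  have hcX : 2 * (R₁ * R₂) ≤ c * R₁ * R₂ := by nlinarith
  have hX2 : Real.log 2 ≤ X := Real.log_le_log (by norm_num) (by linarith)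
  have hX0 : 0 < X := hl2.trans_le hX2
  have htX : (t:ℝ) ≤ 3 * X := by
    have h1 : ((2:ℝ) ^ Nat.log 2 N) ≤ c * R₁ * R₂ := by
      have : ((2 ^ Nat.log 2 N : ℕ) : ℝ) ≤ N := by exact_mod_cast Nat.pow_log_le_self 2 (by omega)
      push_cast at this
      linarith
    have h2 := Real.log_le_log (by positivity) h1
    rw [Real.log_pow, ← hX] at h2
    rw [ht]
    push_cast
    have h3 := Real.log_two_gt_d9
    have h4 : ((Nat.log 2 N : ℝ) + 1) * Real.log 2 ≤ 2 * X := by linarith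
    nlinarith
  have key : c * R₁ * R₂ - (9 * C / Real.log 2 ^ ε + 1 / Real.log 2 ^ (2 + ε)) * X ^ (2 + ε) ≤ n := by
    have hDN := hD (R₁ * R₂) (by linarith)
    rw [← hN] at hDN
    have h1 : (C:ℝ) * t ^ 2 ≤ 9 * C / Real.log 2 ^ ε * X ^ (2 + ε) := by
      have e : X ^ (2 + ε) = X ^ 2 * X ^ ε := by rw [Real.rpow_add hX0, Real.rpow_two]
      have h2 : 1 ≤ X ^ ε / Real.log 2 ^ ε := by
        rw [one_le_div (by positivity)]
        exact Real.rpow_le_rpow hl2.le hX2 hε.le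
      calc (C:ℝ) * t ^ 2 ≤ C * (3 * X) ^ 2 := by gcongr
        _ = 9 * C * X ^ 2 * 1 := by ring
        _ ≤ 9 * C * X ^ 2 * (X ^ ε / Real.log 2 ^ ε) := by gcongr
        _ = _ := by rw [e]; ring
    have h2 : 1 ≤ 1 / Real.log 2 ^ (2 + ε) * X ^ (2 + ε) := by
      rw [one_div, inv_mul_eq_div, one_le_div (by positivity)]
      exact Real.rpow_le_rpow hl2.le hX2 (by linarith)
    rw [add_mul]
    linarith
  rw [ENat.toENNReal_coe]
  have : (((n : ℕ) : ℝ≥0∞) : EReal) = ((n : ℝ) : EReal) := by norm_cast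
  rw [this]
  exact_mod_cast key

/-! ### The general, even and odd cases -/

theorem trigPoly_neg {N : ℕ} {R : ℝ} {c : ℤ → ℂ} (x : ℝ) :
    trigPoly N R c (-x) = trigPoly N R (fun n => c (-n)) x := by
  unfold trigPoly
  refine Finset.sum_nbij' (fun n => -n) (fun n => -n) ?_ ?_ ?_ ?_ ?_
  · intro n hn; simp only [Finset.mem_Icc] at hn ⊢; omega
  · intro n hn; simp only [Finset.mem_Icc] at hn ⊢; omega
  · intro n _; simp
  · intro n _; simp
  · intro n _
    simp only [neg_neg]
    congr 2
    push_cast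
    ring

theorem theorem1 {ι κ : Type*}
    (S : SummationFilter ι) [S.NeBot] [S.LeAtTop]
    (T : SummationFilter κ) [T.NeBot] [T.LeAtTop]
    (Λ : ι → ℝ) (r : ι → ℕ) (a : ι → ℝ → ℂ)
    (M : κ → ℝ) (k : κ → ℕ) (b : κ → ℝ → ℂ) (L : ℝ)
    (hk : ∀ j, (k j : ℝ) ≤ L)
    (hM : ∀ᶠ R : ℝ in Filter.atTop, ((countIn M R : ℕ∞) : ℝ≥0∞) ≤ ENNReal.ofReal (R ^ L))
    (hb : ∃ (K : ℝ) (N : ℕ), ∀ (j : κ) (x : ℝ), ‖b j x‖ ≤ K * (1 + |x| + |M j|) ^ N) :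
    (InterpolationFormula (fun _ => True) S T Λ r a M k b → CountingLowerBound 4 Λ M) ∧
    (InterpolationFormula Function.Even S T Λ r a M k b → CountingLowerBound 2 Λ M) ∧
    (InterpolationFormula Function.Odd S T Λ r a M k b → CountingLowerBound 2 Λ M) := by
  refine ⟨fun h => ?_, fun h => ?_, fun h => ?_⟩
  · obtain ⟨C, hC⟩ := h.exists_dimension_le hk hM hb
    refine .of_dimension_le (D := fun N => 2 * N + 1) (by norm_num) (fun x hx => ?_)
      ⟨C, fun R₁ R₂ hR₁ hR₂ N t ht hN hNt _ => hC R₁ R₂ hR₁ hR₂ N t ht hN hNt _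
        (LinearMap.pi fun n : ℤ => if h : (n + N).toNat < 2 * N + 1 then
          LinearMap.proj ⟨(n + N).toNat, h⟩ else 0) ?_ fun _ _ _ => trivial⟩
    · have := Nat.lt_floor_add_one (2 * x)
      push_cast
      linarith
    · intro c hc
      funext i
      have := hc (i - N) (abs_le.2 ⟨by omega, by omega⟩)
      rw [LinearMap.pi_apply, dif_pos (by omega)] at this
      simpa using this
  · obtain ⟨C, hC⟩ := h.exists_dimension_le hk hM hb
    -- Even polynomials: the coefficient depends only on `|n|`, leaving `N + 1` parameters.
    refine .of_dimension_le (D := fun N => N + 1) le_rfl (fun x hx => ?_)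
      ⟨C, fun R₁ R₂ hR₁ hR₂ N t ht hN hNt _ => hC R₁ R₂ hR₁ hR₂ N t ht hN hNt _
        (LinearMap.pi fun n : ℤ => if h : n.natAbs < N + 1 then
          LinearMap.proj ⟨n.natAbs, h⟩ else 0) ?_ ?_⟩
    · have := Nat.lt_floor_add_one (2 * x)
      push_cast
      linarith
    · intro c hc
      funext i
      have := hc i (abs_le.2 ⟨by omega, by omega⟩)
      rw [LinearMap.pi_apply, dif_pos (by omega)] at this
      simpa using this
    · intro c χ hχ x
      simp only [hχ, trigPoly_neg, LinearMap.pi_apply, Int.natAbs_neg]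
      rfl
  · obtain ⟨C, hC⟩ := h.exists_dimension_le hk hM hb
    -- Odd polynomials: `N` parameters, indexed by `|n| - 1` and multiplied by the sign of `n`. At
    -- `n = 0` the truncated index is harmless because the sign is 0.
    refine .of_dimension_le (D := fun N => N) le_rfl (fun x hx => ?_)
      ⟨C, fun R₁ R₂ hR₁ hR₂ N t ht hN hNt _ => hC R₁ R₂ hR₁ hR₂ N t ht hN hNt _
        (LinearMap.pi fun n : ℤ => (n.sign : ℂ) • if h : n.natAbs - 1 < N then
          LinearMap.proj ⟨n.natAbs - 1, h⟩ else 0) ?_ ?_⟩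
    · have := Nat.lt_floor_add_one (2 * x)
      linarith
    · intro c hc
      funext i
      have := hc (i + 1) (abs_le.2 ⟨by omega, by omega⟩)
      rw [LinearMap.pi_apply, dif_pos (by omega)] at this
      have hs : ((i : ℕ) + 1 : ℤ).sign = 1 := Int.sign_eq_one_of_pos (by omega)
      have hn : ((i : ℕ) + 1 : ℤ).natAbs = i + 1 := by omega
      simpa [hs, hn] using this
    · intro c χ hχ x
      simp only [hχ, trigPoly_neg]
      rw [← mul_neg]
      congr 1
      simp only [trigPoly, LinearMap.pi_apply, Int.natAbs_neg, Int.sign_neg, ← Finset.sum_neg_distrib]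
      refine Finset.sum_congr rfl fun n _ => ?_
      split_ifs <;> simp
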